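/- Let $p$ be an odd prime. For group elements write $[g,h]=g^{-1}h^{-1}gh$, and write $\langle g\rangle^G$ for the normal closure of $g$ in $G$. Simple commutators in the variables $x,a_1,a_2,\ldots$ are the formal group words defined recursively as follows: $x,a_1,a_2,\ldots$ are simple commutators, and if $u,v$ are simple commutators then so is $[u,v]$. If $x$ occurs $m$ times and $a_i$ occurs $e_i$ times in a simple commutator $s$, then the type of $s$ is $t(s)=e_1+e_2+\cdots-2m$. Let $G=\langle x,a_1,a_2,\ldots\rangle$ be the largest group satisfying the following conditions (that is, it satisfies them, and every group $\langle y,b_1,b_2,\ldots\rangle$ whose generators satisfy them is a homomorphic image of $G$ via $x\mapsto y$, $a_i\mapsto b_i$): 1. $\langle a_i\rangle^G$ is abelian for all $i\ge 1$; 2. $\langle x\rangle^G$ is metabelian; 3. $x^p=a_1^p=a_2^p=\cdots=1$; 4. if $s$ is a simple commutator in $x,a_1,a_2,\ldots$ other than the word $x$, and $|t(s)|\ge 2$, then $s=1$ in $G$. Then $G$ is a locally finite $p$-group (every element has order a power of $p$, and every finitely generated subgroup is finite), $x$ is a left $3$-Engel element of $G$, that is, $[[[g,x],x],x]=1$ for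 all $g\in G$, but $\langle x\rangle^G$ is not nilpotent. -/

import Mathlib

namespace EngelExample

/-- The group commutator `[g, h] = g⁻¹ h⁻¹ g h`. -/
def comm {G : Type*} [Group G] (g h : G) : G := g⁻¹ * h⁻¹ * g * h

/-- The left-normed commutator `[g, x, …, x]` with `n` occurrences of `x`. -/
def iterComm {G : Type*} [Group G] (g x : G) : ℕ → G
  | 0 => g
  | n + 1 => comm (iterComm g x n) x

/-- `x` is a left `n`-Engel element of `G`: `[g, x, …, x] = 1` (`n` times `x`) for all `g`. -/
def IsLeftEngel {G : Type*} [Group G] (n : ℕ) (x : G) : Prop :=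
  ∀ g : G, iterComm g x n = 1

/-- Every finitely generated subgroup is finite. -/
def IsLocallyFiniteGroup (G : Type*) [Group G] : Prop :=
  ∀ H : Subgroup G, H.FG → Finite H

/-- Simple commutators in the variables `x, a₀, a₁, …`, as formal words. -/
inductive SimpleComm : Type
  | x : SimpleComm
  | a (i : ℕ) : SimpleComm
  | bracket (u v : SimpleComm) : SimpleComm

namespace SimpleComm

/-- The number of occurrences of `x`. -/
def xWeight : SimpleComm → ℕ
  | x => 1
  | a _ => 0
  | bracket u v => u.xWeight + v.xWeight

/-- The total number of occurrences of the variables `aᵢ`. -/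
def aWeight : SimpleComm → ℕ
  | x => 0
  | a _ => 1
  | bracket u v => u.aWeight + v.aWeight

/-- The type of a simple commutator. -/
def type (s : SimpleComm) : ℤ := (s.aWeight : ℤ) - 2 * (s.xWeight : ℤ)

/-- The value of a simple commutator in a group. -/
def eval {G : Type*} [Group G] (gx : G) (ga : ℕ → G) : SimpleComm → G
  | x => gx
  | a i => ga i
  | bracket u v => comm (u.eval gx ga) (v.eval gx ga)

end SimpleComm

/-- `G` is generated by `x, a₀, a₁, …` and satisfies the four defining conditions. -/
structure IsAdmissible (p : ℕ) {G : Type*} [Group G] (x : G) (a : ℕ → G) : Prop where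
  generates : Subgroup.closure (insert x (Set.range a)) = ⊤
  abelian : ∀ i, ∀ g ∈ Subgroup.normalClosure {a i}, ∀ h ∈ Subgroup.normalClosure {a i},
    g * h = h * g
  metabelian : derivedSeries (Subgroup.normalClosure {x}) 2 = ⊥
  x_pow : x ^ p = 1
  a_pow : ∀ i, a i ^ p = 1
  simple : ∀ s : SimpleComm, s ≠ .x → 2 ≤ |s.type| → s.eval x a = 1

/-- The variables: `none` stands for `x` and `some i` for `aᵢ`. -/
abbrev Var : Type := Option ℕ

/-- The variable `x` in the free group. -/
def freeX : FreeGroup Var := FreeGroup.of none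

/-- The variable `aᵢ` in the free group. -/
def freeA (i : ℕ) : FreeGroup Var := FreeGroup.of (some i)

/-- The relators expressing the four conditions. -/
inductive Relator (p : ℕ) : FreeGroup Var → Prop
  | abelian (i : ℕ) (g h : FreeGroup Var) (hg : g ∈ Subgroup.normalClosure {freeA i})
      (hh : h ∈ Subgroup.normalClosure {freeA i}) : Relator p (comm g h)
  | metabelian (g₁ g₂ g₃ g₄ : FreeGroup Var) (h₁ : g₁ ∈ Subgroup.normalClosure {freeX})
      (h₂ : g₂ ∈ Subgroup.normalClosure {freeX}) (h₃ : g₃ ∈ Subgroup.normalClosure {freeX})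
      (h₄ : g₄ ∈ Subgroup.normalClosure {freeX}) :
      Relator p (comm (comm g₁ g₂) (comm g₃ g₄))
  | x_pow : Relator p (freeX ^ p)
  | a_pow (i : ℕ) : Relator p (freeA i ^ p)
  | simple (s : SimpleComm) (hs : s ≠ .x) (ht : 2 ≤ |s.type|) : Relator p (s.eval freeX freeA)

/-- The largest group `G = ⟨x, a₀, a₁, …⟩` satisfying the four conditions. -/
abbrev EngelGroup (p : ℕ) : Type := PresentedGroup {r | Relator p r}

/-- The generator `x` of `EngelGroup p`. -/
def genX (p : ℕ) : EngelGroup p := PresentedGroup.of none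

/-- The generator `aᵢ` of `EngelGroup p`. -/
def genA (p : ℕ) (i : ℕ) : EngelGroup p := PresentedGroup.of (some i)

theorem comm_eq_one_iff {G : Type*} [Group G] (g h : G) : comm g h = 1 ↔ g * h = h * g := by
  unfold comm
  constructor
  · intro e
    have := congrArg (fun t => h * g * t) e
    simpa [mul_assoc] using this
  · intro e
    rw [mul_assoc, e]; group

theorem map_comm {G H : Type*} [Group G] [Group H] (f : G →* H) (g h : G) :
    f (comm g h) = comm (f g) (f h) := by simp [comm]

theorem map_eval {G H : Type*} [Group G] [Group H] (f : G →* H) (x : G) (a : ℕ → G)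
    (s : SimpleComm) : f (s.eval x a) = s.eval (f x) (fun i => f (a i)) := by
  induction s with
  | x => rfl
  | a i => rfl
  | bracket u v hu hv => simp [SimpleComm.eval, map_comm, hu, hv]

open scoped commutatorElement in
/-- A subgroup is metabelian iff the commutators of its elements commute. -/
theorem metabelian_iff {G : Type*} [Group G] (N : Subgroup G) :
    derivedSeries N 2 = ⊥ ↔ ∀ g₁ ∈ N, ∀ g₂ ∈ N, ∀ g₃ ∈ N, ∀ g₄ ∈ N,
      comm (comm g₁ g₂) (comm g₃ g₄) = 1 := by
  have key : derivedSeries N 2 = ⁅⁅(⊤ : Subgroup N), ⊤⁆, ⁅(⊤ : Subgroup N), ⊤⁆⁆ := rfl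
  rw [key, Subgroup.commutator_eq_bot_iff_le_centralizer, Subgroup.commutator_def,
    Subgroup.closure_le]
  rw [Subgroup.centralizer_closure]
  constructor
  · intro h g₁ h₁ g₂ h₂ g₃ h₃ g₄ h₄
    have m := @h ⁅(⟨g₁, h₁⟩ : N)⁻¹, (⟨g₂, h₂⟩ : N)⁻¹⁆
      ⟨_, Subgroup.mem_top _, _, Subgroup.mem_top _, rfl⟩
    have m' := (Subgroup.mem_centralizer_iff.1 m) ⁅(⟨g₃, h₃⟩ : N)⁻¹, (⟨g₄, h₄⟩ : N)⁻¹⁆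
      ⟨_, Subgroup.mem_top _, _, Subgroup.mem_top _, rfl⟩
    have m'' := congrArg Subtype.val m'
    rw [comm_eq_one_iff]
    simpa [comm, commutatorElement_def] using m''.symm
  · rintro h _ ⟨u, -, v, -, rfl⟩
    refine Subgroup.mem_centralizer_iff.2 ?_
    rintro _ ⟨u', -, v', -, rfl⟩
    have := h _ (inv_mem u.2) _ (inv_mem v.2) _ (inv_mem u'.2) _ (inv_mem v'.2)
    rw [comm_eq_one_iff] at this
    apply Subtype.ext
    simpa [comm, commutatorElement_def] using this.symm

/-- `EngelGroup p` satisfies the four conditions. -/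
theorem isAdmissible_engelGroup (p : ℕ) : IsAdmissible p (genX p) (genA p) := by
  let f : FreeGroup Var →* EngelGroup p := PresentedGroup.mk _
  have hf : Function.Surjective f := PresentedGroup.mk_surjective _
  have rel : ∀ r, Relator p r → f r = 1 := fun r hr =>
    PresentedGroup.one_of_mem hr
  have lift : ∀ w : FreeGroup Var, ∀ g ∈ Subgroup.normalClosure {f w},
      ∃ g' ∈ Subgroup.normalClosure {w}, f g' = g := by
    intro w g hg
    have := Subgroup.map_normalClosure {w} f hf
    rw [Set.image_singleton] at this
    rw [← this] at hg
    exact hg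
  refine ⟨?_, ?_, ?_, ?_, ?_, ?_⟩
  · rw [← PresentedGroup.closure_range_of]
    congr 1
    ext g
    constructor
    · rintro (rfl | ⟨i, rfl⟩)
      · exact ⟨none, rfl⟩
      · exact ⟨some i, rfl⟩
    · rintro ⟨_ | i, rfl⟩
      · exact Or.inl rfl
      · exact Or.inr ⟨i, rfl⟩
  · intro i g hg h hh
    obtain ⟨g, hg', rfl⟩ := lift (freeA i) g hg
    obtain ⟨h, hh', rfl⟩ := lift (freeA i) h hh
    rw [← comm_eq_one_iff, ← map_comm]
    exact rel _ (.abelian i g h hg' hh')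
  · rw [metabelian_iff]
    intro g₁ h₁ g₂ h₂ g₃ h₃ g₄ h₄
    obtain ⟨g₁, k₁, rfl⟩ := lift freeX g₁ h₁
    obtain ⟨g₂, k₂, rfl⟩ := lift freeX g₂ h₂
    obtain ⟨g₃, k₃, rfl⟩ := lift freeX g₃ h₃
    obtain ⟨g₄, k₄, rfl⟩ := lift freeX g₄ h₄
    simp only [← map_comm]
    exact rel _ (.metabelian g₁ g₂ g₃ g₄ k₁ k₂ k₃ k₄)
  · exact (map_pow f freeX p).symm.trans (rel _ .x_pow)
  · exact fun i => (map_pow f (freeA i) p).symm.trans (rel _ (.a_pow i))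
  · exact fun s hs ht => (map_eval f freeX freeA s).symm.trans (rel _ (.simple s hs ht))

/-- `EngelGroup p` is the largest such group: any other is a quotient of it, with the generators
corresponding. -/
theorem engelGroup_largest (p : ℕ) {H : Type*} [Group H] {y : H} {b : ℕ → H}
    (h : IsAdmissible p y b) : ∃! f : EngelGroup p →* H,
      Function.Surjective f ∧ f (genX p) = y ∧ ∀ i, f (genA p i) = b i := by
  let c : Var → H := fun o => o.elim y b
  let F : FreeGroup Var →* H := FreeGroup.lift c
  have Fx : F freeX = y := FreeGroup.lift_apply_of
  have Fa : ∀ i, F (freeA i) = b i := fun i => FreeGroup.lift_apply_of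
  have mapN : ∀ w g, g ∈ Subgroup.normalClosure {w} → F g ∈ Subgroup.normalClosure {F w} := by
    intro w g hg
    have : Subgroup.normalClosure {w} ≤ (Subgroup.normalClosure {F w}).comap F :=
      Subgroup.normalClosure_le_normal (by
        rintro _ rfl
        exact Subgroup.subset_normalClosure rfl)
    exact this hg
  have rel : ∀ r ∈ {r | Relator p r}, F r = 1 := by
    rintro _ (⟨i, g, h', hg, hh⟩ | ⟨g₁, g₂, g₃, g₄, h₁, h₂, h₃, h₄⟩ | _ | i | ⟨s, hs, ht⟩)
    · rw [map_comm, comm_eq_one_iff]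
      have hg := mapN _ _ hg
      have hh := mapN _ _ hh
      rw [Fa] at hg hh
      exact h.abelian i _ hg _ hh
    · have h₁ := mapN _ _ h₁
      have h₂ := mapN _ _ h₂
      have h₃ := mapN _ _ h₃
      have h₄ := mapN _ _ h₄
      rw [Fx] at h₁ h₂ h₃ h₄
      simp only [map_comm]
      exact (metabelian_iff _).1 h.metabelian _ h₁ _ h₂ _ h₃ _ h₄
    · rw [map_pow, Fx, h.x_pow]
    · rw [map_pow, Fa, h.a_pow]
    · rw [map_eval, Fx, funext Fa, h.simple s hs ht]
  have ex : ∀ o, PresentedGroup.toGroup (f := c) rel (PresentedGroup.of o) = c o :=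
    fun o => PresentedGroup.toGroup.of rel
  refine ⟨PresentedGroup.toGroup (f := c) rel, ⟨?_, ex none, fun i => ex (some i)⟩, ?_⟩
  · rw [← MonoidHom.range_eq_top, eq_top_iff, ← h.generates, Subgroup.closure_le]
    rintro _ (rfl | ⟨i, rfl⟩)
    · exact ⟨_, ex none⟩
    · exact ⟨_, ex (some i)⟩
  · rintro g ⟨-, gx, ga⟩
    apply PresentedGroup.ext
    rintro (_ | i)
    · exact gx.trans (ex none).symm
    · exact (ga i).trans (ex (some i)).symm

end EngelExample

/-! The group is an ascending union of the products of `⟨x⟩` with finitely many of the normal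
closures `⟨aᵢ⟩ᴳ`. These closures are abelian of exponent dividing `p`, so `G` is a locally finite
`p`-group because both properties pass to extensions.

Engel property. A simple commutator with a repeated `aᵢ` is trivial, so in finitely many `aᵢ` all
sufficiently long ones vanish, and collection by weight writes `[g, x]` as `c * v * b`. Here `c` is
a product of commutators of type at most `0`, `v` of commutators of type `1` involving `x`, and `b`
lies in `⟨a₀, a₁, …⟩` (inverses allowed throughout). Killing `x` retracts `G` onto the abelian group
`⟨a₀, a₁, …⟩`, and `b` lies in `⟨x⟩ᴳ`, so `b = 1`. Types add under brackets: `[c, x]` has generators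
of type at most `-2`, hence `c` commutes with `x`, while `[v, x, x] = 1` holds on generators and
extends to products because `⟨x⟩ᴳ` is metabelian. The carrying lemmas are `exists_eq_mul`,
`commute_comm_of_mem_onePartX` and `eq_one_of_mem_closure_genA_of_mem_normalClosure`.

Non-nilpotency. `G` acts through units `1 + n` of an exterior algebra tensored with `5 × 5`
matrices: `x` goes to `1 + X` and `aᵢ` to `1 + eᵢ ⊗ Aᵢ`. A simple commutator then goes to `1` plus a
monomial times an iterated superbracket (`SimpleComm.val_eval`). The superbrackets other than `X`
itself live in degrees `-1, 0, 1`, the degree being the type, which gives condition 4; the last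
column is an abelian extension of a `4 × 4` block on which conjugates of `x` commute, which gives
condition 2. Finally `[x, a₁, a₂]` acts on the last column of a degree `-1` matrix as multiplication
by the identity, up to a monomial, so commutators with such elements never die (`mat_longComm`). -/

namespace EngelExample

open Subgroup

/-! ### Locally finite subgroups -/

section LocallyFinite

variable {G : Type*} [Group G]

/-- Every finitely generated subgroup of `A` is finite. -/
def SubgroupLocallyFinite (A : Subgroup G) : Prop :=
  ∀ K : Subgroup G, K ≤ A → K.FG → Finite K

theorem fg_map {H : Type*} [Group H] {K : Subgroup G} (hK : K.FG) (f : G →* H) :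
    (K.map f).FG := by
  classical
  obtain ⟨S, rfl⟩ := hK
  exact ⟨S.image f, by rw [MonoidHom.map_closure, Finset.coe_image]⟩

/-- The kernel of `K → G/N` has finite index in the finitely generated group `K`, so it is itself
finitely generated; lying in `N`, it is finite. -/
theorem finite_of_finite_map_of_finite_inf {N K : Subgroup G} [N.Normal]
    (h₁ : Finite (K.map (QuotientGroup.mk' N))) (h₂ : ∀ L : Subgroup G, L ≤ N → L.FG → Finite L)
    (hK : K.FG) : Finite K := by
  let f : K →* K.map (QuotientGroup.mk' N) := (QuotientGroup.mk' N).subgroupMap K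
  have hker : f.ker.FiniteIndex := by
    have : Finite f.range := inferInstance
    exact finiteIndex_ker f
  have : Group.FG K := (Group.fg_iff_subgroup_fg K).2 hK
  have fgk : Group.FG f.ker := inferInstance
  have fg' : (f.ker.map K.subtype).FG := fg_map ((Group.fg_iff_subgroup_fg _).1 fgk) _
  have le : f.ker.map K.subtype ≤ N := by
    rintro _ ⟨k, hk, rfl⟩
    have := congrArg Subtype.val (MonoidHom.mem_ker.1 hk)
    exact (QuotientGroup.eq_one_iff _).1 this
  have fin := h₂ _ le fg'
  have : Finite f.ker :=
    Finite.of_equiv _ (f.ker.equivMapOfInjective K.subtype K.subtype_injective).symm.toEquiv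
  exact Nat.finite_of_card_ne_zero (by
    rw [← f.ker.card_mul_index]
    exact mul_ne_zero Nat.card_pos.ne' hker.index_ne_zero)

theorem exists_fg_map_eq {H : Type*} [Group H] (f : G →* H) {A : Subgroup G} {L : Subgroup H}
    (hL : L ≤ A.map f) (fg : L.FG) : ∃ B ≤ A, B.FG ∧ B.map f = L := by
  obtain ⟨S, rfl⟩ := fg
  have : ∀ s ∈ S, ∃ a ∈ A, f a = s := fun s hs => hL (subset_closure hs)
  choose! g hg hfg using this
  classical
  refine ⟨closure (g '' S), (closure_le _).2 ?_, ⟨S.image g, by simp⟩, ?_⟩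
  · rintro _ ⟨s, hs, rfl⟩
    exact hg s hs
  · rw [MonoidHom.map_closure, Set.image_image]
    congr 1
    ext s
    constructor
    · rintro ⟨t, ht, rfl⟩
      change f (g t) ∈ _
      rwa [hfg t ht]
    · exact fun hs => ⟨s, hs, hfg s hs⟩

theorem SubgroupLocallyFinite.sup {A N : Subgroup G} [N.Normal] (hA : SubgroupLocallyFinite A)
    (hN : SubgroupLocallyFinite N) : SubgroupLocallyFinite (A ⊔ N) := by
  intro K hK fg
  have le : K.map (QuotientGroup.mk' N) ≤ A.map (QuotientGroup.mk' N) := by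
    refine (map_mono hK).trans ?_
    rw [Subgroup.map_sup, QuotientGroup.map_mk'_self, sup_bot_eq]
  obtain ⟨B, hB, hfg, e⟩ := exists_fg_map_eq _ le (fg_map fg _)
  have := hA B hB hfg
  refine finite_of_finite_map_of_finite_inf (N := N) ?_ hN fg
  rw [← e]
  exact Finite.of_surjective _ ((QuotientGroup.mk' N).subgroupMap_surjective B)

theorem subgroupLocallyFinite_of_comm {A : Subgroup G} (hc : ∀ g ∈ A, ∀ h ∈ A, g * h = h * g)
    (ht : ∀ g ∈ A, IsOfFinOrder g) : SubgroupLocallyFinite A := by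
  intro K hK fg
  let _ : CommGroup K := { (inferInstance : Group K) with
    mul_comm := fun a b => Subtype.ext (hc _ (hK a.2) _ (hK b.2)) }
  have : Group.FG K := (Group.fg_iff_subgroup_fg K).2 fg
  refine CommGroup.finite_of_fg_isMulTorsion (G := K) fun k => ?_
  exact Submonoid.isOfFinOrder_coe (H := K.toSubmonoid).1 (ht k (hK k.2))

/-- A subgroup generated by commuting elements killed by `n` is killed by `n`. -/
theorem pow_eq_one_of_mem_normalClosure {a : G} {n : ℕ} (ha : a ^ n = 1)
    (hc : ∀ g ∈ normalClosure {a}, ∀ h ∈ normalClosure {a}, g * h = h * g) :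
    ∀ g ∈ normalClosure {a}, g ^ n = 1 := by
  intro g hg
  induction hg using closure_induction with
  | mem y hy =>
    obtain ⟨_, rfl, h⟩ := Group.mem_conjugatesOfSet_iff.1 hy
    obtain ⟨c, rfl⟩ := isConj_iff.1 h
    rw [conj_pow, ha, mul_one, mul_inv_cancel]
  | one => exact one_pow n
  | mul u v hu hv iu iv =>
    rw [(show Commute u v from hc u hu v hv).mul_pow, iu, iv, one_mul]
  | inv u _ iu => rw [inv_pow, iu, inv_one]

end LocallyFinite

/-! ### Admissible groups are locally finite `p`-groups. -/

namespace IsAdmissible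

variable {p : ℕ} {G : Type*} [Group G] {x : G} {a : ℕ → G}

/-- The subgroup generated by `x` and the normal closures of the first `n` generators `aᵢ`. -/
def stage (x : G) (a : ℕ → G) : ℕ → Subgroup G
  | 0 => zpowers x
  | n + 1 => stage x a n ⊔ normalClosure {a n}

theorem stage_mono : Monotone (stage x a) :=
  monotone_nat_of_le_succ fun _ => le_sup_left

theorem exists_mem_stage (h : IsAdmissible p x a) (g : G) : ∃ n, g ∈ stage x a n := by
  have hg : g ∈ closure (insert x (Set.range a)) := h.generates ▸ mem_top g
  induction hg using closure_induction with
  | mem y hy =>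
    rcases hy with rfl | ⟨i, rfl⟩
    · exact ⟨0, mem_zpowers _⟩
    · exact ⟨i + 1, mem_sup_right (subset_normalClosure rfl)⟩
  | one => exact ⟨0, one_mem _⟩
  | mul u v _ _ hu hv =>
    obtain ⟨m, hm⟩ := hu
    obtain ⟨n, hn⟩ := hv
    exact ⟨max m n, mul_mem (stage_mono (le_max_left _ _) hm) (stage_mono (le_max_right _ _) hn)⟩
  | inv u _ hu =>
    obtain ⟨m, hm⟩ := hu
    exact ⟨m, inv_mem hm⟩

theorem isPGroup_stage (h : IsAdmissible p x a) (n : ℕ) : IsPGroup p (stage x a n) := by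
  induction n with
  | zero =>
    rintro ⟨_, k, rfl⟩
    refine ⟨1, Subtype.ext ?_⟩
    change (x ^ k) ^ (p ^ 1) = 1
    rw [pow_one, ← zpow_natCast, zpow_comm, zpow_natCast, h.x_pow, one_zpow]
  | succ n ih =>
    refine ih.to_sup_of_normal_right ?_
    rintro ⟨g, hg⟩
    refine ⟨1, Subtype.ext ?_⟩
    change g ^ (p ^ 1) = 1
    rw [pow_one]
    exact pow_eq_one_of_mem_normalClosure (h.a_pow n) (h.abelian n) g hg

theorem isPGroup (h : IsAdmissible p x a) : IsPGroup p G := by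
  intro g
  obtain ⟨n, hn⟩ := h.exists_mem_stage g
  obtain ⟨k, hk⟩ := h.isPGroup_stage n ⟨g, hn⟩
  exact ⟨k, congrArg Subtype.val hk⟩

theorem isOfFinOrder (h : IsAdmissible p x a) (hp : p.Prime) (g : G) : IsOfFinOrder g := by
  obtain ⟨k, hk⟩ := h.isPGroup g
  exact isOfFinOrder_iff_pow_eq_one.2 ⟨p ^ k, pow_pos hp.pos k, hk⟩

theorem subgroupLocallyFinite_stage (h : IsAdmissible p x a) (hp : p.Prime) (n : ℕ) :
    SubgroupLocallyFinite (stage x a n) := by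
  induction n with
  | zero =>
    refine subgroupLocallyFinite_of_comm ?_ fun g _ => h.isOfFinOrder hp g
    rintro _ ⟨k, rfl⟩ _ ⟨l, rfl⟩
    exact (Commute.refl x).zpow_zpow k l
  | succ n ih =>
    exact ih.sup (subgroupLocallyFinite_of_comm (h.abelian n) fun g _ => h.isOfFinOrder hp g)

theorem isLocallyFiniteGroup (h : IsAdmissible p x a) (hp : p.Prime) :
    IsLocallyFiniteGroup G := by
  intro H hH
  obtain ⟨S, rfl⟩ := hH
  choose n hn using h.exists_mem_stage
  refine h.subgroupLocallyFinite_stage hp (S.sup n) _ ((closure_le _).2 fun s hs => ?_) ⟨S, rfl⟩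
  exact stage_mono (Finset.le_sup hs) (hn s)

end IsAdmissible

end EngelExample


namespace EngelExample

open Subgroup

/-! ### Commutator identities -/

section Comm

variable {G : Type*} [Group G]

theorem comm_inv (g h : G) : (comm g h)⁻¹ = comm h g := by
  simp [comm, mul_assoc]

theorem comm_mul_left_of_commute {c x : G} (h : Commute c x) (u : G) :
    comm (c * u) x = comm u x := by
  have : c⁻¹ * x⁻¹ * c = x⁻¹ := by rw [h.inv_inv.eq, inv_mul_cancel_right]
  calc comm (c * u) x = u⁻¹ * (c⁻¹ * x⁻¹ * c) * u * x := by simp [comm, mul_assoc]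
    _ = comm u x := by rw [this, comm]

theorem comm_mem_of_left {N : Subgroup G} [hN : N.Normal] {g : G} (hg : g ∈ N) (h : G) :
    comm g h ∈ N := by
  have := N.mul_mem (N.inv_mem hg) (hN.conj_mem g hg h⁻¹)
  simpa [comm, mul_assoc] using this

theorem comm_mem_of_right {N : Subgroup G} [hN : N.Normal] {h : G} (hh : h ∈ N) (g : G) :
    comm g h ∈ N := by
  rw [← comm_inv]
  exact N.inv_mem (comm_mem_of_left hh g)

theorem comm_one_left (g : G) : comm 1 g = 1 := by simp [comm]

theorem comm_one_right (g : G) : comm g 1 = 1 := by simp [comm]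

/-- In a torsion group, a subgroup normalized by generators in one direction is normalized. -/
theorem conj_mem_of_mem_closure (ht : ∀ g : G, IsOfFinOrder g) {S T : Set G}
    (hST : ∀ s ∈ S, ∀ t ∈ T, t⁻¹ * s * t ∈ closure S) {y : G} (hy : y ∈ closure T) :
    ∀ g ∈ closure S, y⁻¹ * g * y ∈ closure S := by
  induction hy using closure_induction with
  | mem t htT =>
    intro g hg
    induction hg using closure_induction with
    | mem s hs => exact hST s hs t htT
    | one => simp
    | mul u v _ _ hu hv => simpa [mul_assoc] using mul_mem hu hv
    | inv u _ hu => simpa [mul_assoc] using inv_mem hu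
  | one => simp
  | mul u v _ _ hu hv =>
    intro g hg
    simpa [mul_assoc] using hv _ (hu g hg)
  | inv u _ hu =>
    -- Torsion makes `u⁻¹` a nonnegative power of `u`, so invariance under conjugation by `u` is
    -- enough.
    have key : ∀ m : ℕ, ∀ g ∈ closure S, (u ^ m)⁻¹ * g * u ^ m ∈ closure S := by
      intro m
      induction m with
      | zero => simp
      | succ m ih =>
        intro g hg
        simpa [pow_succ, mul_assoc] using hu _ (ih g hg)
    obtain ⟨k, hk, e⟩ := isOfFinOrder_iff_pow_eq_one.1 (ht u)
    obtain ⟨m, rfl⟩ := Nat.exists_eq_succ_of_ne_zero hk.ne'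
    rw [pow_succ] at e
    rw [← eq_inv_of_mul_eq_one_left e]
    exact key m

theorem comm_mem_of_mem_closure {S T : Set G} {N : Subgroup G} (hST : S ⊆ closure T)
    (hN : ∀ y ∈ closure T, ∀ g ∈ N, y⁻¹ * g * y ∈ N) (hc : ∀ s ∈ S, ∀ t ∈ T, comm s t ∈ N)
    {g y : G} (hg : g ∈ closure S) (hy : y ∈ closure T) : comm g y ∈ N := by
  have hST' : closure S ≤ closure T := (closure_le _).2 hST
  have key : ∀ y ∈ closure T, (∀ s ∈ S, comm s y ∈ N) → ∀ g ∈ closure S, comm g y ∈ N := by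
    intro y _ h g hg
    induction hg using closure_induction with
    | mem s hs => exact h s hs
    | one => simp [comm_one_left]
    | mul u v hu hv iu iv =>
      have := mul_mem (hN v (hST' hv) _ iu) iv
      have e : v⁻¹ * comm u y * v * comm v y = comm (u * v) y := by simp [comm, mul_assoc]
      rwa [e] at this
    | inv u hu iu =>
      have := hN u⁻¹ (inv_mem (hST' hu)) _ (inv_mem iu)
      have e : u⁻¹⁻¹ * (comm u y)⁻¹ * u⁻¹ = comm u⁻¹ y := by simp [comm, mul_assoc]
      rwa [e] at this
  refine key y hy (fun s hs => ?_) g hg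
  induction hy using closure_induction with
  | mem t ht => exact hc s hs t ht
  | one => simp [comm_one_right]
  | mul u v hu hv iu iv =>
    have := mul_mem iv (hN v hv _ iu)
    have e : comm s v * (v⁻¹ * comm s u * v) = comm s (u * v) := by simp [comm, mul_assoc]
    rwa [e] at this
  | inv u hu iu =>
    have := hN u⁻¹ (inv_mem hu) _ (inv_mem iu)
    have e : u⁻¹⁻¹ * (comm s u)⁻¹ * u⁻¹ = comm s u⁻¹ := by simp [comm, mul_assoc]
    rwa [e] at this

/-- Collecting elements of a section `closure S / N` that is central modulo `N`. -/
theorem exists_mul_mul_eq {P Q N : Subgroup G} {S : Set G} (hS : ∀ s ∈ S, s ∈ P ∨ s ∈ Q)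
    (hN : ∀ y ∈ closure S, ∀ g ∈ N, y⁻¹ * g * y ∈ N)
    (hc : ∀ g ∈ closure S, ∀ u ∈ Q, comm g u ∈ N) {d : G} (hd : d ∈ closure S)
    {c u : G} (hcP : c ∈ P) (hu : u ∈ Q) :
    ∃ c' ∈ P, ∃ u' ∈ Q, ∃ e ∈ N, c * u * d = c' * u' * e := by
  have key : ∀ y ∈ closure S, (y ∈ P ∨ y ∈ Q) → ∀ c ∈ P, ∀ u ∈ Q, ∀ e ∈ N,
      ∃ c' ∈ P, ∃ u' ∈ Q, ∃ e' ∈ N, c * u * e * y = c' * u' * e' := by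
    intro y hyS hy c hc' u hu e he
    rcases hy with hy | hy
    · refine ⟨c * y, mul_mem hc' hy, u, hu, _,
        mul_mem (inv_mem (hc y hyS u hu)) (hN y hyS e he), ?_⟩
      simp [comm, mul_assoc]
    · refine ⟨c, hc', u * y, mul_mem hu hy, _, hN y hyS e he, ?_⟩
      simp [mul_assoc]
  induction hd using closure_induction_right with
  | one => exact ⟨c, hcP, u, hu, 1, one_mem _, rfl⟩
  | mul_right d _ y hy ih =>
    obtain ⟨c', hc', u', hu', e, he, h⟩ := ih
    rw [← mul_assoc, h]
    exact key y (subset_closure hy) (hS y hy) c' hc' u' hu' e he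
  | mul_inv_cancel d _ y hy ih =>
    obtain ⟨c', hc', u', hu', e, he, h⟩ := ih
    rw [← mul_assoc, h]
    exact key y⁻¹ (inv_mem (subset_closure hy)) ((hS y hy).imp inv_mem inv_mem) c' hc' u' hu' e he

end Comm

/-! ### Simple commutators -/

namespace SimpleComm

/-- The indices `i` of the variables `aᵢ` in a simple commutator, from left to right. -/
def letters : SimpleComm → List ℕ
  | x => []
  | a i => [i]
  | bracket u v => u.letters ++ v.letters

theorem length_letters (s : SimpleComm) : s.letters.length = s.aWeight := by
  induction s with
  | x => rfl
  | a i => rfl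
  | bracket u v hu hv => simp [letters, aWeight, hu, hv]

theorem type_bracket (u v : SimpleComm) : (bracket u v).type = u.type + v.type := by
  simp only [type, aWeight, xWeight]
  push_cast
  ring

theorem weight_pos (s : SimpleComm) : 0 < s.xWeight + s.aWeight := by
  induction s with
  | x => simp [xWeight]
  | a i => simp [aWeight]
  | bracket u v hu hv => simp only [xWeight, aWeight]; omega

theorem xWeight_pos {s : SimpleComm} (h : s.type ≤ 0) : 0 < s.xWeight := by
  have := s.weight_pos
  simp only [type] at h
  omega

variable {G : Type*} [Group G] {gx : G} {ga : ℕ → G}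

theorem eval_mem_normalClosure_x {s : SimpleComm} (h : 0 < s.xWeight) :
    s.eval gx ga ∈ normalClosure {gx} := by
  induction s with
  | x => exact subset_normalClosure rfl
  | a i => simp [xWeight] at h
  | bracket u v hu hv =>
    simp only [xWeight] at h
    rcases Nat.eq_zero_or_pos u.xWeight with h' | h'
    · exact comm_mem_of_right (hv (by omega)) _
    · exact comm_mem_of_left (hu h') _

theorem eval_mem_normalClosure_a {s : SimpleComm} {i : ℕ} (h : i ∈ s.letters) :
    s.eval gx ga ∈ normalClosure {ga i} := by
  induction s with
  | x => simp [letters] at h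
  | a j =>
    obtain rfl : i = j := by simpa [letters] using h
    exact subset_normalClosure rfl
  | bracket u v hu hv =>
    rcases List.mem_append.1 h with h | h
    · exact comm_mem_of_left (hu h) _
    · exact comm_mem_of_right (hv h) _

end SimpleComm

/-! ### Collection by type and weight, and the Engel condition. -/

namespace IsAdmissible

variable {p : ℕ} {G : Type*} [Group G] {x : G} {a : ℕ → G}

/-- In `[u, v]` with a letter `i` common to `u` and `v`, both values lie in the abelian group
`⟨aᵢ⟩ᴳ`. -/
theorem eval_eq_one_of_not_nodup (h : IsAdmissible p x a) {s : SimpleComm}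
    (hs : ¬ s.letters.Nodup) : s.eval x a = 1 := by
  induction s with
  | x => simp [SimpleComm.letters] at hs
  | a i => simp [SimpleComm.letters] at hs
  | bracket u v hu hv =>
    by_cases h₁ : u.letters.Nodup
    · by_cases h₂ : v.letters.Nodup
      · simp only [SimpleComm.letters, List.nodup_append', h₁, h₂, true_and, List.Disjoint] at hs
        push Not at hs
        obtain ⟨i, hiu, hiv⟩ := hs
        exact (comm_eq_one_iff _ _).2 (h.abelian i _ (SimpleComm.eval_mem_normalClosure_a hiu) _
          (SimpleComm.eval_mem_normalClosure_a hiv.1))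
      · rw [SimpleComm.eval, hv h₂, comm_one_right]
    · rw [SimpleComm.eval, hu h₁, comm_one_left]

/-- Without repetition the `aᵢ` contribute at most `n` to the weight, so `x` occurs at least `n + 2`
times and the type is far below `-2`. This is what terminates the collection process. -/
theorem eval_eq_one_of_weight (h : IsAdmissible p x a) {s : SimpleComm} {n : ℕ}
    (hs : ∀ i ∈ s.letters, i < n) (hw : 2 * n + 2 ≤ s.xWeight + s.aWeight) :
    s.eval x a = 1 := by
  by_cases hd : s.letters.Nodup
  · have : s.letters.length ≤ n := by
      have := (hd.subperm (l₂ := List.range n) fun i hi => List.mem_range.2 (hs i hi)).length_le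
      simpa using this
    rw [SimpleComm.length_letters] at this
    refine h.simple s ?_ ?_
    · rintro rfl
      simp [SimpleComm.xWeight, SimpleComm.aWeight] at hw
    · rw [SimpleComm.type, le_abs]
      right
      omega
  · exact h.eval_eq_one_of_not_nodup hd

theorem commute_eval_of_type_nonpos (h : IsAdmissible p x a) {s : SimpleComm} (hs : s.type ≤ 0) :
    Commute (s.eval x a) x := by
  refine (comm_eq_one_iff _ _).1 (h.simple (.bracket s .x) (by simp) ?_)
  rw [SimpleComm.type_bracket, le_abs]
  right
  have : SimpleComm.x.type = -2 := rfl
  omega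

/-- The values of the simple commutators of weight at least `k` in the first `n` variables `aᵢ`. -/
def termGens (x : G) (a : ℕ → G) (n k : ℕ) : Set G :=
  {g | ∃ s : SimpleComm, (∀ i ∈ s.letters, i < n) ∧ k ≤ s.xWeight + s.aWeight ∧ s.eval x a = g}

theorem termGens_anti {n m k l : ℕ} (h : k ≤ l) (hn : n ≤ m) :
    termGens x a n l ⊆ termGens x a m k := by
  rintro _ ⟨s, h₁, h₂, rfl⟩
  exact ⟨s, fun i hi => (h₁ i hi).trans_le hn, h.trans h₂, rfl⟩

theorem comm_mem_termGens {n k : ℕ} {g y : G} (hg : g ∈ termGens x a n k)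
    (hy : y ∈ termGens x a n 1) : comm g y ∈ termGens x a n (k + 1) := by
  obtain ⟨s, h₁, h₂, rfl⟩ := hg
  obtain ⟨t, h₃, h₄, rfl⟩ := hy
  refine ⟨.bracket s t, ?_, ?_, rfl⟩
  · intro i hi
    exact (List.mem_append.1 hi).elim (h₁ i) (h₃ i)
  · simp only [SimpleComm.xWeight, SimpleComm.aWeight]
    omega

theorem conj_mem_closure_termGens (h : IsAdmissible p x a) (hp : p.Prime) {n k : ℕ} {y : G}
    (hy : y ∈ closure (termGens x a n 1)) :
    ∀ g ∈ closure (termGens x a n k), y⁻¹ * g * y ∈ closure (termGens x a n k) := by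
  refine conj_mem_of_mem_closure (h.isOfFinOrder hp) (fun s hs t ht => ?_) hy
  have := mul_mem (subset_closure hs)
    (subset_closure (termGens_anti (Nat.le_succ k) le_rfl (comm_mem_termGens hs ht)))
  simpa [comm, mul_assoc] using this

theorem comm_mem_closure_termGens (h : IsAdmissible p x a) (hp : p.Prime) {n k : ℕ} (hk : 1 ≤ k)
    {g y : G} (hg : g ∈ closure (termGens x a n k)) (hy : y ∈ closure (termGens x a n 1)) :
    comm g y ∈ closure (termGens x a n (k + 1)) :=
  comm_mem_of_mem_closure ((termGens_anti hk le_rfl).trans subset_closure)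
    (fun _ hy => h.conj_mem_closure_termGens hp hy)
    (fun _ hs _ ht => subset_closure (comm_mem_termGens hs ht)) hg hy

theorem exists_mem_closure_termGens (h : IsAdmissible p x a) (g : G) :
    ∃ n, g ∈ closure (termGens x a n 1) := by
  have hg : g ∈ closure (insert x (Set.range a)) := h.generates ▸ mem_top g
  have mono : ∀ {m n : ℕ}, m ≤ n → closure (termGens x a m 1) ≤ closure (termGens x a n 1) :=
    fun hmn => closure_mono (termGens_anti le_rfl hmn)
  induction hg using closure_induction with
  | mem y hy =>
    rcases hy with rfl | ⟨i, rfl⟩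
    · exact ⟨0, subset_closure ⟨.x, by simp [SimpleComm.letters], by simp [SimpleComm.xWeight],
        rfl⟩⟩
    · exact ⟨i + 1, subset_closure ⟨.a i, by simp [SimpleComm.letters],
        by simp [SimpleComm.aWeight], rfl⟩⟩
  | one => exact ⟨0, one_mem _⟩
  | mul u v _ _ hu hv =>
    obtain ⟨m, hm⟩ := hu
    obtain ⟨n, hn⟩ := hv
    exact ⟨max m n, mul_mem (mono (le_max_left _ _) hm) (mono (le_max_right _ _) hn)⟩
  | inv u _ hu =>
    obtain ⟨m, hm⟩ := hu
    exact ⟨m, inv_mem hm⟩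

/-- The subgroup generated by the simple commutators of type at most `0`. -/
def nonposPart (x : G) (a : ℕ → G) : Subgroup G :=
  closure {g | ∃ s : SimpleComm, s.type ≤ 0 ∧ s.eval x a = g}

/-- The subgroup generated by the simple commutators of type `1`. -/
def onePart (x : G) (a : ℕ → G) : Subgroup G :=
  closure {g | ∃ s : SimpleComm, s.type = 1 ∧ s.eval x a = g}

/-- The subgroup generated by the simple commutators of type `1` involving `x`. -/
def onePartX (x : G) (a : ℕ → G) : Subgroup G :=
  closure {g | ∃ s : SimpleComm, s.type = 1 ∧ 0 < s.xWeight ∧ s.eval x a = g}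

theorem nonposPart_le : nonposPart x a ≤ normalClosure {x} := by
  rw [nonposPart, closure_le]
  rintro _ ⟨s, hs, rfl⟩
  exact SimpleComm.eval_mem_normalClosure_x (SimpleComm.xWeight_pos hs)

theorem onePartX_le : onePartX x a ≤ normalClosure {x} := by
  rw [onePartX, closure_le]
  rintro _ ⟨s, -, hs, rfl⟩
  exact SimpleComm.eval_mem_normalClosure_x hs

theorem commute_of_mem_nonposPart (h : IsAdmissible p x a) {g : G} (hg : g ∈ nonposPart x a) :
    Commute g x := by
  induction hg using closure_induction with
  | mem y hy =>
    obtain ⟨s, hs, rfl⟩ := hy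
    exact h.commute_eval_of_type_nonpos hs
  | one => exact Commute.one_left x
  | mul u v _ _ hu hv => exact hu.mul_left hv
  | inv u _ hu => exact hu.inv_left

/-- The terms generated by commutators of weight at least `k` are central modulo the next ones, so
factors of each weight can be sorted by type, leaving a remainder of higher weight. Types above `1`
contribute nothing. -/
theorem exists_eq_mul (h : IsAdmissible p x a) (hp : p.Prime) (g : G) :
    ∃ c ∈ nonposPart x a, ∃ u ∈ onePart x a, g = c * u := by
  obtain ⟨n, hn⟩ := h.exists_mem_closure_termGens g
  have step : ∀ k, ∃ c ∈ nonposPart x a,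
      ∃ u ∈ onePart x a ⊓ closure (termGens x a n 1),
      ∃ d ∈ closure (termGens x a n (k + 1)), g = c * u * d := by
    intro k
    induction k with
    | zero => exact ⟨1, one_mem _, 1, one_mem _, g, hn, by simp⟩
    | succ k ih =>
      obtain ⟨c, hc, u, hu, d, hd, rfl⟩ := ih
      have le : closure (termGens x a n (k + 1)) ≤ closure (termGens x a n 1) :=
        closure_mono (termGens_anti (by omega) le_rfl)
      refine exists_mul_mul_eq (P := nonposPart x a)
        (Q := onePart x a ⊓ closure (termGens x a n 1)) ?_
        (fun y hy => h.conj_mem_closure_termGens hp (le hy))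
        (fun y hy u hu => h.comm_mem_closure_termGens hp (by omega) hy hu.2) hd hc hu
      intro y hy
      have hy1 := le (subset_closure hy)
      obtain ⟨s, -, -, rfl⟩ := hy
      rcases lt_trichotomy s.type 1 with ht | ht | ht
      · exact Or.inl (subset_closure ⟨s, by omega, rfl⟩)
      · exact Or.inr ⟨subset_closure ⟨s, ht, rfl⟩, hy1⟩
      · refine Or.inl ?_
        rw [h.simple s (by rintro rfl; exact absurd ht (by decide)) (le_abs.2 (Or.inl (by omega)))]
        exact one_mem _
  -- The remainder has weight at least `2 * n + 2`, where all commutators in the first `n` letters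
  -- vanish.
  obtain ⟨c, hc, u, hu, d, hd, e⟩ := step (2 * n + 1)
  have : closure (termGens x a n (2 * n + 2)) = ⊥ := by
    rw [closure_eq_bot_iff]
    rintro _ ⟨s, h₁, h₂, rfl⟩
    exact h.eval_eq_one_of_weight h₁ h₂
  rw [this, mem_bot] at hd
  exact ⟨c, hc, u, hu.1, by rw [e, hd, mul_one]⟩

theorem commute_of_mem_onePart (h : IsAdmissible p x a) {g k : G} (hg : g ∈ onePart x a)
    (hk : k ∈ onePart x a) : Commute g k := by
  have := isMulCommutative_closure (k := {g | ∃ s : SimpleComm, s.type = 1 ∧ s.eval x a = g}) (by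
    rintro _ ⟨s, hs, rfl⟩ _ ⟨t, ht, rfl⟩
    refine (comm_eq_one_iff _ _).1 (h.simple (.bracket s t) (by simp) ?_)
    rw [SimpleComm.type_bracket, hs, ht]
    decide)
  exact congrArg Subtype.val (this.is_comm.comm (⟨g, hg⟩ : onePart x a) ⟨k, hk⟩)

/-- A commutator of type `1` without `x` has a single letter, so it is some `aᵢ`; since `onePart` is
abelian, these factors can be gathered on the right. -/
theorem exists_eq_mul_of_mem_onePart (h : IsAdmissible p x a) {g : G} (hg : g ∈ onePart x a) :
    ∃ v ∈ onePartX x a, ∃ b ∈ closure (Set.range a), g = v * b := by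
  have le : onePartX x a ≤ onePart x a := closure_mono (by
    rintro _ ⟨s, hs, -, rfl⟩
    exact ⟨s, hs, rfl⟩)
  have le' : closure (Set.range a) ≤ onePart x a := closure_mono (by
    rintro _ ⟨i, rfl⟩
    exact ⟨.a i, rfl, rfl⟩)
  induction hg using closure_induction with
  | mem y hy =>
    obtain ⟨s, hs, rfl⟩ := hy
    rcases Nat.eq_zero_or_pos s.xWeight with h0 | h0
    · refine ⟨1, one_mem _, s.eval x a, ?_, (one_mul _).symm⟩
      cases s with
      | x => simp [SimpleComm.xWeight] at h0
      | a i => exact subset_closure ⟨i, rfl⟩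
      | bracket u v =>
        have := u.weight_pos
        have := v.weight_pos
        simp only [SimpleComm.type, SimpleComm.xWeight, SimpleComm.aWeight] at hs h0
        omega
    · exact ⟨_, subset_closure ⟨s, hs, h0, rfl⟩, 1, one_mem _, (mul_one _).symm⟩
  | one => exact ⟨1, one_mem _, 1, one_mem _, (mul_one _).symm⟩
  | mul _ _ _ _ hu hw =>
    obtain ⟨v, hv, b, hb, rfl⟩ := hu
    obtain ⟨v', hv', b', hb', rfl⟩ := hw
    refine ⟨v * v', mul_mem hv hv', b * b', mul_mem hb hb', ?_⟩
    exact (h.commute_of_mem_onePart (le' hb) (le hv')).mul_mul_mul_comm v b'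
  | inv _ _ hu =>
    obtain ⟨v, hv, b, hb, rfl⟩ := hu
    refine ⟨v⁻¹, inv_mem hv, b⁻¹, inv_mem hb, ?_⟩
    rw [mul_inv_rev, ← mul_inv_rev, (h.commute_of_mem_onePart (le hv) (le' hb)).eq, mul_inv_rev]

/-- The elements `v` of the metabelian group `⟨x⟩ᴳ` such that `[v, x, x] = 1` form a subgroup,
which contains the simple commutators of type `1` involving `x`. -/
theorem commute_comm_of_mem_onePartX (h : IsAdmissible p x a) {v : G} (hv : v ∈ onePartX x a) :
    Commute (comm v x) x := by
  have hx : x ∈ normalClosure {x} := subset_normalClosure rfl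
  have met := (metabelian_iff _).1 h.metabelian
  have conj : ∀ u ∈ normalClosure {x}, ∀ w ∈ normalClosure {x}, Commute (comm u x) x →
      Commute (w⁻¹ * comm u x * w) x := by
    intro u hu w hw hc
    -- Two commutators of the metabelian group `⟨x⟩ᴳ` commute. As `x * [x, w⁻¹] = w * x * w⁻¹`, it
    -- follows that `[u, x]` commutes with `w * x * w⁻¹`; conjugating by `w` gives the claim.
    have h₁ : Commute (comm u x) (comm x w⁻¹) :=
      (comm_eq_one_iff _ _).1 (met u hu x hx x hx _ (inv_mem hw))
    have h₂ : Commute (comm u x) (w * x * w⁻¹) := by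
      have := hc.mul_right h₁
      simpa [comm, mul_assoc] using this
    have h₃ := h₂.map (MulAut.conj w⁻¹).toMonoidHom
    simpa [mul_assoc] using h₃
  induction hv using closure_induction with
  | mem y hy =>
    obtain ⟨s, hs, -, rfl⟩ := hy
    -- The type here is `1 - 2 - 2 = -3`.
    refine (comm_eq_one_iff _ _).1 (h.simple (.bracket (.bracket s .x) .x) (by simp) ?_)
    rw [SimpleComm.type_bracket, SimpleComm.type_bracket, hs]
    decide
  | one => rw [comm_one_left]; exact Commute.one_left x
  | mul u v hu hv iu iv =>
    have e : comm (u * v) x = v⁻¹ * comm u x * v * comm v x := by simp [comm, mul_assoc]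
    rw [e]
    exact (conj u (onePartX_le hu) v (onePartX_le hv) iu).mul_left iv
  | inv u hu iu =>
    have e : comm u⁻¹ x = (u⁻¹⁻¹ * comm u x * u⁻¹)⁻¹ := by simp [comm, mul_assoc]
    rw [e]
    exact (conj u (onePartX_le hu) u⁻¹ (inv_mem (onePartX_le hu)) iu).inv_left

theorem isLeftEngel (h : IsAdmissible p x a) (hp : p.Prime)
    (hr : ∀ b ∈ closure (Set.range a), b ∈ normalClosure {x} → b = 1) : IsLeftEngel 3 x := by
  intro g
  have hx : x ∈ normalClosure {x} := subset_normalClosure rfl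
  change comm (comm (comm g x) x) x = 1
  obtain ⟨c, hc, u, hu, e⟩ := h.exists_eq_mul hp (comm g x)
  obtain ⟨v, hv, b, hb, rfl⟩ := h.exists_eq_mul_of_mem_onePart hu
  have hb1 : b = 1 := by
    refine hr b hb ?_
    have e' : b = v⁻¹ * (c⁻¹ * comm g x) := by rw [e]; simp
    rw [e']
    exact mul_mem (inv_mem (onePartX_le hv))
      (mul_mem (inv_mem (nonposPart_le hc)) (comm_mem_of_right hx g))
  rw [e, hb1, mul_one, comm_mul_left_of_commute (h.commute_of_mem_nonposPart hc)]
  exact (comm_eq_one_iff _ _).2 (h.commute_comm_of_mem_onePartX hv)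

end IsAdmissible

/-! ### The retraction onto the subgroup generated by the `aᵢ` -/

theorem commute_of_mem_closure_genA {p : ℕ} {g h : EngelGroup p}
    (hg : g ∈ closure (Set.range (genA p))) (hh : h ∈ closure (Set.range (genA p))) :
    g * h = h * g := by
  have le : closure (Set.range (genA p)) ≤ IsAdmissible.onePart (genX p) (genA p) :=
    closure_mono (by
      rintro _ ⟨i, rfl⟩
      exact ⟨.a i, rfl, rfl⟩)
  exact (isAdmissible_engelGroup p).commute_of_mem_onePart (le hg) (le hh)

/-- Used with `engelGroup_largest` to obtain the retraction of `EngelGroup p` that kills `x` and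
fixes every `aᵢ`. The group is abelian because `[aᵢ, aⱼ]` has type `2`. -/
theorem isAdmissible_closure_genA (p : ℕ) :
    IsAdmissible p (1 : closure (Set.range (genA p)))
      (fun i => ⟨genA p i, subset_closure ⟨i, rfl⟩⟩) := by
  have hc : ∀ g h : closure (Set.range (genA p)), g * h = h * g := fun g h =>
    Subtype.ext (commute_of_mem_closure_genA g.2 h.2)
  refine ⟨?_, fun _ g _ h _ => hc g h, ?_, one_pow p, ?_, ?_⟩
  · rw [eq_top_iff, ← map_le_map_iff_of_injective (subtype_injective _),
      MonoidHom.map_closure, ← MonoidHom.range_eq_map, range_subtype]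
    refine closure_mono ?_
    rintro _ ⟨i, rfl⟩
    exact ⟨_, Or.inr ⟨i, rfl⟩, rfl⟩
  · rw [metabelian_iff]
    intros
    exact (comm_eq_one_iff _ _).2 (hc _ _)
  · exact fun i => Subtype.ext ((isAdmissible_engelGroup p).a_pow i)
  · intro s hs ht
    cases s with
    | x => exact absurd rfl hs
    | a i => exact absurd ht (by simp [SimpleComm.type, SimpleComm.aWeight, SimpleComm.xWeight])
    | bracket u v => exact (comm_eq_one_iff _ _).2 (hc _ _)

theorem eq_one_of_mem_closure_genA_of_mem_normalClosure {p : ℕ} {b : EngelGroup p}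
    (hb : b ∈ closure (Set.range (genA p))) (hb' : b ∈ normalClosure {genX p}) : b = 1 := by
  obtain ⟨r, ⟨-, rx, ra⟩, -⟩ := engelGroup_largest p (isAdmissible_closure_genA p)
  have h₁ : normalClosure {genX p} ≤ r.ker :=
    normalClosure_le_normal (by rintro _ rfl; exact rx)
  have h₂ : ((r b : closure (Set.range (genA p))) : EngelGroup p) = b := by
    clear hb'
    induction hb using closure_induction with
    | mem y hy =>
      obtain ⟨i, rfl⟩ := hy
      rw [ra]
    | one => simp
    | mul u v _ _ hu hv => simp [hu, hv]
    | inv u _ hu => simp [hu]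
  rw [← h₂, MonoidHom.mem_ker.1 (h₁ hb')]
  rfl

theorem isLeftEngel_genX {p : ℕ} (hp : p.Prime) : IsLeftEngel 3 (genX p) :=
  (isAdmissible_engelGroup p).isLeftEngel hp fun _ =>
    eq_one_of_mem_closure_genA_of_mem_normalClosure

end EngelExample


namespace EngelExample

open Subgroup

open scoped TensorProduct

/-! ### Groups of units of the form `1 + n` -/

section SquareZero

variable {A : Type*} [Ring A]

/-- The unit `1 + n` for an element `n` of square zero. -/
def oneAddUnit (n : A) (h : n * n = 0) : Aˣ where
  val := 1 + n
  inv := 1 - n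
  val_inv := by simp [mul_sub, add_mul, h]
  inv_val := by simp [mul_add, sub_mul, h]

theorem val_inv_of_sq_eq_zero {u : Aˣ} {n : A} (hu : (u : A) = 1 + n) (h : n * n = 0) :
    ((u⁻¹ : Aˣ) : A) = 1 - n := by
  have : u = oneAddUnit n h := Units.ext hu
  rw [this]
  rfl

/-- Under these vanishing conditions every term beyond the quadratic ones disappears, so group
commutators become ring commutators. -/
theorem val_comm {u v : Aˣ} {m n : A} (hu : (u : A) = 1 + m) (hv : (v : A) = 1 + n)
    (hm : m * m = 0) (hn : n * n = 0) (hmn : m * n * m = 0) (hnm : n * m * n = 0) :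
    ((comm u v : Aˣ) : A) = 1 + (m * n - n * m) := by
  simp only [comm, Units.val_mul, val_inv_of_sq_eq_zero hu hm, val_inv_of_sq_eq_zero hv hn, hu, hv]
  have e : (1 - m) * (1 - n) * (1 + m) * (1 + n) = 1 + (m * n - n * m) - m * m - n * n
      + m * n * m + m * (n * n) - n * m * n - (m * m) * n + m * n * m * n := by noncomm_ring
  rw [e, hm, hn, hmn, hnm]
  simp

theorem one_add_pow_of_sq_eq_zero {n : A} (h : n * n = 0) (k : ℕ) :
    (1 + n) ^ k = 1 + k • n := by
  induction k with
  | zero => simp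
  | succ k ih => simp [pow_succ, ih, mul_add, add_mul, h, add_smul, add_assoc, add_comm n, -nsmul_eq_mul]

/-- If `S` is a commutative additive subgroup stable under conjugation, and `w` maps into `1 + S`,
then the normal closure of `w` has commutative image. -/
theorem commute_of_mem_normalClosure (F : FreeGroup Var →* Aˣ) (S : AddSubgroup A)
    (hS : ∀ y ∈ S, ∀ z ∈ S, y * z = z * y)
    (hF : ∀ o, ∃ n : A, n * n = 0 ∧ (F (FreeGroup.of o) : A) = 1 + n ∧
      ∀ z ∈ S, n * z - z * n ∈ S ∧ n * z * n ∈ S)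
    {w : FreeGroup Var} (hw : ∃ z ∈ S, (F w : A) = 1 + z) :
    ∀ g ∈ normalClosure {w}, ∀ h ∈ normalClosure {w}, F g * F h = F h * F g := by
  have conj : ∀ g : FreeGroup Var, ∀ z ∈ S, (F g : A) * z * ((F g)⁻¹ : Aˣ) ∈ S := by
    intro g
    induction g using FreeGroup.induction_on with
    | C1 => simp
    | of o =>
      obtain ⟨n, hn, e, h⟩ := hF o
      intro z hz
      rw [val_inv_of_sq_eq_zero e hn, e]
      have : (1 + n) * z * (1 - n) = z + (n * z - z * n) - n * z * n := by noncomm_ring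
      rw [this]
      exact S.sub_mem (S.add_mem hz (h z hz).1) (h z hz).2
    | inv_of o _ =>
      obtain ⟨n, hn, e, h⟩ := hF o
      intro z hz
      rw [map_inv, inv_inv, val_inv_of_sq_eq_zero e hn, e]
      have : (1 - n) * z * (1 + n) = z - (n * z - z * n) - n * z * n := by noncomm_ring
      rw [this]
      exact S.sub_mem (S.sub_mem hz (h z hz).1) (h z hz).2
    | mul u v hu hv =>
      intro z hz
      simpa [mul_assoc] using hu _ (hv z hz)
  have gens : ∀ g ∈ Group.conjugatesOfSet {w}, ∃ z ∈ S, (F g : A) = 1 + z := by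
    intro g hg
    obtain ⟨_, rfl, hc⟩ := Group.mem_conjugatesOfSet_iff.1 hg
    obtain ⟨c, rfl⟩ := isConj_iff.1 hc
    obtain ⟨z, hz, e⟩ := hw
    refine ⟨_, conj c z hz, ?_⟩
    simp [e, mul_add, add_mul]
  have := isMulCommutative_closure (k := F '' Group.conjugatesOfSet {w}) (by
    rintro _ ⟨g, hg, rfl⟩ _ ⟨h, hh, rfl⟩
    obtain ⟨y, hy, ey⟩ := gens g hg
    obtain ⟨z, hz, ez⟩ := gens h hh
    apply Units.ext
    simp only [Units.val_mul, ey, ez, mul_add, add_mul, one_mul, mul_one, hS y hy z hz]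
    abel)
  have mem : ∀ g ∈ normalClosure {w}, F g ∈ closure (F '' Group.conjugatesOfSet {w}) := by
    intro g hg
    rw [← MonoidHom.map_closure]
    exact mem_map_of_mem F hg
  intro g hg h hh
  exact congrArg Subtype.val (this.is_comm.comm ⟨F g, mem g hg⟩ ⟨F h, mem h hh⟩)

end SquareZero

/-! ### Monomials in the exterior algebra -/

section Word

variable (K : Type*) [CommRing K]

/-- The exterior algebra on countably many generators. -/
abbrev Grassmann : Type _ := ExteriorAlgebra K (ℕ →₀ K)

/-- The product of the generators of the exterior algebra with indices in `l`. -/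
noncomputable def word (l : List ℕ) : Grassmann K :=
  (l.map fun i => ExteriorAlgebra.ι K (Finsupp.single i (1 : K))).prod

theorem word_nil : word K [] = 1 := rfl

theorem word_append (l l' : List ℕ) : word K (l ++ l') = word K l * word K l' := by
  simp [word]

theorem word_mul_single (l : List ℕ) (i : ℕ) :
    word K l * word K [i] = (-1 : K) ^ l.length • (word K [i] * word K l) := by
  induction l with
  | nil => simp [word_nil]
  | cons j l ih =>
    have hj : word K (j :: l) = word K [j] * word K l := word_append K [j] l
    have swap : word K [j] * word K [i] = -(word K [i] * word K [j]) := by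
      simpa [word] using eq_neg_of_add_eq_zero_left (ExteriorAlgebra.ι_add_mul_swap
        (R := K) (Finsupp.single j (1 : K)) (Finsupp.single i (1 : K)))
    rw [hj, mul_assoc, ih, mul_smul_comm, ← mul_assoc, swap, List.length_cons, pow_succ]
    simp [mul_assoc]

theorem word_mul_comm (l l' : List ℕ) :
    word K l * word K l' = (-1 : K) ^ (l.length * l'.length) • (word K l' * word K l) := by
  induction l' with
  | nil => simp [word_nil]
  | cons i l' ih =>
    have hi : word K (i :: l') = word K [i] * word K l' := word_append K [i] l'
    rw [hi, ← mul_assoc, word_mul_single, smul_mul_assoc, mul_assoc, ih, mul_smul_comm, smul_smul,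
      mul_assoc, List.length_cons, Nat.mul_succ, pow_add, mul_comm (_ ^ _)]

theorem word_eq_ιMulti (l : List ℕ) : word K l =
    ExteriorAlgebra.ιMulti K l.length (fun i => Finsupp.single (l.get i) (1 : K)) := by
  rw [ExteriorAlgebra.ιMulti_apply, word]
  congr 1
  conv_lhs => rw [← List.ofFn_get l, List.map_ofFn]
  rfl

theorem word_eq_zero {l : List ℕ} (h : ¬ l.Nodup) : word K l = 0 := by
  rw [List.nodup_iff_injective_get] at h
  rw [word_eq_ιMulti]
  exact AlternatingMap.map_eq_zero_of_not_injective _ _ fun hi => h fun i j e => hi (by simp only [e])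

/-- The functional is the determinant of the coordinates listed in `l`, extended by zero to the
other exterior degrees. -/
theorem exists_word_eq_one {l : List ℕ} (h : l.Nodup) :
    ∃ f : Grassmann K →ₗ[K] K, f (word K l) = 1 := by
  let g : (ℕ →₀ K) →ₗ[K] (Fin l.length → K) := LinearMap.pi fun i => Finsupp.lapply (l.get i)
  let d : (ℕ →₀ K) [⋀^Fin l.length]→ₗ[K] K := Matrix.detRowAlternating.compLinearMap g
  refine ⟨ExteriorAlgebra.liftAlternating
    (Function.update (fun _ => 0) l.length d), ?_⟩
  rw [word_eq_ιMulti, ExteriorAlgebra.liftAlternating_apply_ιMulti, Function.update_self]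
  have e : (fun i => g (Finsupp.single (l.get i) (1 : K))) = (1 : Matrix _ _ K) := by
    ext i j
    have := (List.nodup_iff_injective_get.1 h).eq_iff (a := i) (b := j)
    change Finsupp.single (l.get i) (1 : K) (l.get j) = _
    rw [Finsupp.single_apply, Matrix.one_apply]
    simp only [this]
  change Matrix.det (fun i => g (Finsupp.single (l.get i) (1 : K))) = 1
  rw [e, Matrix.det_one]

end Word

/-! ### Matrices over the exterior algebra -/

section Model

variable (K : Type*) [CommRing K]

/-- The `5 × 5` matrices. -/
abbrev Mat : Type _ := Matrix (Fin 5) (Fin 5) K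

/-- The algebra of matrices over the exterior algebra. -/
def Model : Type _ := Grassmann K ⊗[K] Mat K

noncomputable instance : Ring (Model K) := inferInstanceAs (Ring (Grassmann K ⊗[K] Mat K))

noncomputable instance : Algebra K (Model K) :=
  inferInstanceAs (Algebra K (Grassmann K ⊗[K] Mat K))

variable {K}

/-- The matrix `m` with coefficient `word K l`. -/
noncomputable def mono (l : List ℕ) (m : Mat K) : Model K := word K l ⊗ₜ m

theorem mono_mul (l l' : List ℕ) (m n : Mat K) :
    mono l m * mono l' n = mono (l ++ l') (m * n) := by
  rw [mono, mono, mono, word_append]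
  exact Algebra.TensorProduct.tmul_mul_tmul _ _ _ _

/-- The Koszul sign moves to the matrix factor, so that ordinary commutators in `Model K` become
supercommutators of matrices. -/
theorem mono_mul' (l l' : List ℕ) (m n : Mat K) :
    mono l m * mono l' n = mono (l' ++ l) ((-1 : K) ^ (l.length * l'.length) • (m * n)) := by
  rw [mono_mul, mono, mono, word_append, word_mul_comm, ← word_append, TensorProduct.smul_tmul]

theorem mono_zero (l : List ℕ) : mono l (0 : Mat K) = 0 := TensorProduct.tmul_zero _ _

theorem mono_sub (l : List ℕ) (m n : Mat K) : mono l (m - n) = mono l m - mono l n :=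
  TensorProduct.tmul_sub _ _ _

theorem mono_eq_zero {l : List ℕ} (h : ¬ l.Nodup) (m : Mat K) : mono l m = 0 := by
  rw [mono, word_eq_zero K h]
  exact TensorProduct.zero_tmul _ _

theorem mono_ne_zero {l : List ℕ} (h : l.Nodup) {m : Mat K} {i j : Fin 5} (hm : m i j ≠ 0) :
    mono l m ≠ 0 := by
  obtain ⟨f, hf⟩ := exists_word_eq_one K h
  intro e
  have e' : (word K l ⊗ₜ[K] m : Grassmann K ⊗[K] Mat K) = 0 := e
  have := congrArg (LinearMap.mul' K K ∘ₗ TensorProduct.map f (Matrix.entryLinearMap K K i j)) e'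
  rw [LinearMap.comp_apply, TensorProduct.map_tmul, hf] at this
  simp at this
  exact hm this

/-- The image of `x`. -/
def matX : Mat K := !![0,0,0,1,0; 0,0,0,0,0; 0,0,0,0,0; 0,0,0,0,0; 0,0,0,0,0]

/-- The matrices of degree `1`. -/
def matOne (a b c : K) : Mat K :=
  !![0,0,0,0,0; a,0,0,0,0; b,0,0,0,0; 0,-b,a,0,c; 0,0,0,0,0]

/-- The matrices of degree `0`. -/
def matZero (a b c : K) : Mat K :=
  !![a,0,0,0,0; 0,a,0,0,b; 0,0,a,0,c; 0,0,0,a,0; 0,0,0,0,0]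

/-- The matrices of degree `-1`. -/
def matNeg (a b c : K) : Mat K :=
  !![0,-b,a,0,c; 0,0,0,-a,0; 0,0,0,-b,0; 0,0,0,0,0; 0,0,0,0,0]

theorem matX_mul_matX : (matX : Mat K) * matX = 0 := by
  rw [← sub_eq_zero, ← Matrix.ext_iff]
  simp [matX, Fin.forall_fin_succ]

theorem matX_mul_matZero (a b c : K) : matX * matZero a b c = a • matX := by
  rw [← sub_eq_zero, ← Matrix.ext_iff]
  simp [matX, matZero, Fin.forall_fin_succ]

theorem matZero_mul_matX (a b c : K) : matZero a b c * matX = a • matX := by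
  rw [← sub_eq_zero, ← Matrix.ext_iff]
  simp [matX, matZero, Fin.forall_fin_succ]

theorem matX_mul_matNeg (a b c : K) : matX * matNeg a b c = 0 := by
  rw [← sub_eq_zero, ← Matrix.ext_iff]
  simp [matX, matNeg, Fin.forall_fin_succ]

theorem matNeg_mul_matX (a b c : K) : matNeg a b c * matX = 0 := by
  rw [← sub_eq_zero, ← Matrix.ext_iff]
  simp [matX, matNeg, Fin.forall_fin_succ]

theorem matX_mul_matOne_sub (a b c : K) :
    matX * matOne a b c - matOne a b c * matX = matNeg a b c := by
  rw [← sub_eq_zero, ← Matrix.ext_iff]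
  simp [matX, matOne, matNeg, Fin.forall_fin_succ]

theorem matX_mul_matOne_mul_matX (a b c : K) : matX * matOne a b c * matX = 0 := by
  rw [← sub_eq_zero, ← Matrix.ext_iff]
  simp [matX, matOne, Fin.forall_fin_succ]

theorem matOne_mul_matOne (a b c a' b' c' : K) :
    matOne a b c * matOne a' b' c' + matOne a' b' c' * matOne a b c = 0 := by
  rw [← sub_eq_zero, ← Matrix.ext_iff]
  simp [matOne, Fin.forall_fin_succ]
  ring

theorem matNeg_mul_matNeg (a b c a' b' c' : K) :
    matNeg a b c * matNeg a' b' c' + matNeg a' b' c' * matNeg a b c = 0 := by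
  rw [← sub_eq_zero, ← Matrix.ext_iff]
  simp [matNeg, Fin.forall_fin_succ]
  ring

/-- On the basis `1, e, f, e ∧ f` of the exterior algebra of `K²`, the block of `matOne a b c` is
multiplication by `a e + b f` and that of `matNeg` is a contraction, so their anticommutator is a
scalar on the block, as in a Clifford algebra. The last column records images of an extra basis
vector. -/
theorem matOne_mul_matNeg (a b c a' b' c' : K) :
    matOne a b c * matNeg a' b' c' + matNeg a' b' c' * matOne a b c =
      matZero (b * a' - a * b') (a * c' - a' * c) (b * c' - b' * c) := by
  rw [← sub_eq_zero, ← Matrix.ext_iff]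
  simp [matOne, matNeg, matZero, Fin.forall_fin_succ]
  and_intros <;> ring

theorem matZero_mul_matOne (a b c a' b' c' : K) :
    matZero a b c * matOne a' b' c' - matOne a' b' c' * matZero a b c =
      matOne 0 0 (a * c' + b' * b - a' * c) := by
  rw [← sub_eq_zero, ← Matrix.ext_iff]
  simp [matOne, matZero, Fin.forall_fin_succ]
  and_intros <;> ring

theorem matZero_mul_matNeg (a b c a' b' c' : K) :
    matZero a b c * matNeg a' b' c' - matNeg a' b' c' * matZero a b c =
      matNeg 0 0 (a * c' + b' * b - a' * c) := by
  rw [← sub_eq_zero, ← Matrix.ext_iff]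
  simp [matNeg, matZero, Fin.forall_fin_succ]
  and_intros <;> ring

theorem matZero_mul_matZero (a b c a' b' c' : K) :
    matZero a b c * matZero a' b' c' - matZero a' b' c' * matZero a b c =
      matZero 0 (a * b' - a' * b) (a * c' - a' * c) := by
  rw [← sub_eq_zero, ← Matrix.ext_iff]
  simp [matZero, Fin.forall_fin_succ]
  ring

theorem matOne_zero : matOne (0 : K) 0 0 = 0 := by
  rw [← Matrix.ext_iff]
  simp [matOne, Fin.forall_fin_succ]

theorem matNeg_zero : matNeg (0 : K) 0 0 = 0 := by
  rw [← Matrix.ext_iff]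
  simp [matNeg, Fin.forall_fin_succ]

theorem matOne_neg (a b c : K) : matOne (-a) (-b) (-c) = -matOne a b c := by
  rw [← sub_eq_zero, ← Matrix.ext_iff]
  simp [matOne]

theorem matNeg_neg (a b c : K) : matNeg (-a) (-b) (-c) = -matNeg a b c := by
  rw [← sub_eq_zero, ← Matrix.ext_iff]
  simp [matNeg]

theorem matZero_neg (a b c : K) : matZero (-a) (-b) (-c) = -matZero a b c := by
  rw [← sub_eq_zero, ← Matrix.ext_iff]
  simp [matZero]

end Model

end EngelExample


namespace EngelExample

open Subgroup

/-! ### Values of simple commutators in the matrix model -/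

section Graded

variable {K : Type*} [CommRing K]

/-- The homogeneous components of the Lie superalgebra generated by the model. -/
inductive IsGraded : ℤ → Mat K → Prop
  | neg (a b c : K) : IsGraded (-1) (matNeg a b c)
  | zero (a b c : K) : IsGraded 0 (matZero a b c)
  | one (a b c : K) : IsGraded 1 (matOne a b c)
  | null (t : ℤ) : IsGraded t 0

theorem IsGraded.eq_zero {t : ℤ} {m : Mat K} (h : IsGraded t m) (ht : 2 ≤ |t|) : m = 0 := by
  cases h with
  | null => rfl
  | _ => exact absurd ht (by decide)

/-- The hypotheses `hk` and `hl` match the parity of the degree with that of the exterior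
coefficient, so the sign is exactly the one in the anticommutator or commutator identities above. -/
theorem IsGraded.bracket {s t : ℤ} {m n : Mat K} (hm : IsGraded s m) (hn : IsGraded t n) {k l : ℕ}
    (hk : Even (s - k)) (hl : Even (t - l)) :
    IsGraded (s + t) (m * n - (-1 : K) ^ (k * l) • (n * m)) := by
  have even_left : Even k → (-1 : K) ^ (k * l) = 1 := fun h => (h.mul_right l).neg_one_pow
  have even_right : Even l → (-1 : K) ^ (k * l) = 1 := fun h => (h.mul_left k).neg_one_pow
  have both : Odd k → Odd l → (-1 : K) ^ (k * l) = -1 := fun h h' => (h.mul h').neg_one_pow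
  have odd_k : s = -1 ∨ s = 1 → Odd k := by
    rintro (rfl | rfl) <;> (rw [← Int.odd_coe_nat]; rcases hk with ⟨r, hr⟩)
    · exact ⟨-r - 1, by omega⟩
    · exact ⟨-r, by omega⟩
  have odd_l : t = -1 ∨ t = 1 → Odd l := by
    rintro (rfl | rfl) <;> (rw [← Int.odd_coe_nat]; rcases hl with ⟨r, hr⟩)
    · exact ⟨-r - 1, by omega⟩
    · exact ⟨-r, by omega⟩
  have even_k : s = 0 → Even k := by
    rintro rfl
    simpa using hk
  have even_l : t = 0 → Even l := by
    rintro rfl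
    simpa using hl
  cases hm with
  | null => simpa using IsGraded.null _
  | neg a b c =>
    cases hn with
    | null => simpa using IsGraded.null _
    | neg a' b' c' =>
      rw [both (odd_k (by simp)) (odd_l (by simp)), neg_one_smul, sub_neg_eq_add,
        matNeg_mul_matNeg]
      exact .null _
    | zero a' b' c' =>
      rw [even_right (even_l rfl), one_smul, ← neg_sub, matZero_mul_matNeg, ← matNeg_neg]
      exact .neg _ _ _
    | one a' b' c' =>
      rw [both (odd_k (by simp)) (odd_l (by simp)), neg_one_smul, sub_neg_eq_add,
        add_comm (matNeg a b c * _), matOne_mul_matNeg]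
      exact .zero _ _ _
  | zero a b c =>
    rw [even_left (even_k rfl), one_smul]
    cases hn with
    | null => simpa using IsGraded.null _
    | neg a' b' c' => rw [matZero_mul_matNeg]; exact .neg _ _ _
    | zero a' b' c' => rw [matZero_mul_matZero]; exact .zero _ _ _
    | one a' b' c' => rw [matZero_mul_matOne]; exact .one _ _ _
  | one a b c =>
    cases hn with
    | null => simpa using IsGraded.null _
    | neg a' b' c' =>
      rw [both (odd_k (by simp)) (odd_l (by simp)), neg_one_smul, sub_neg_eq_add,
        matOne_mul_matNeg]
      exact .zero _ _ _
    | zero a' b' c' =>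
      rw [even_right (even_l rfl), one_smul, ← neg_sub, matZero_mul_matOne, ← matOne_neg]
      exact .one _ _ _
    | one a' b' c' =>
      rw [both (odd_k (by simp)) (odd_l (by simp)), neg_one_smul, sub_neg_eq_add,
        matOne_mul_matOne]
      exact .null _

theorem IsGraded.matX_bracket {t : ℤ} {m : Mat K} (h : IsGraded t m) :
    IsGraded (t - 2) (matX * m - m * matX) := by
  cases h with
  | null => simpa using IsGraded.null _
  | neg a b c => rw [matX_mul_matNeg, matNeg_mul_matX, sub_zero]; exact .null _
  | zero a b c => rw [matX_mul_matZero, matZero_mul_matX, sub_self]; exact .null _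
  | one a b c => rw [matX_mul_matOne_sub]; exact .neg a b c

theorem IsGraded.neg_mem {t : ℤ} {m : Mat K} (h : IsGraded t m) : IsGraded t (-m) := by
  cases h with
  | null => simpa using IsGraded.null _
  | neg a b c => rw [← matNeg_neg]; exact .neg _ _ _
  | zero a b c => rw [← matZero_neg]; exact .zero _ _ _
  | one a b c => rw [← matOne_neg]; exact .one _ _ _

theorem IsGraded.matX_mul_mul_matX {t : ℤ} {m : Mat K} (h : IsGraded t m) :
    matX * m * matX = 0 := by
  cases h with
  | null => simp
  | neg a b c => rw [matX_mul_matNeg, zero_mul]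
  | zero a b c => rw [matX_mul_matZero, smul_mul_assoc, matX_mul_matX, smul_zero]
  | one a b c => exact matX_mul_matOne_mul_matX a b c

variable (μ : ℕ → Mat K)

/-- The matrix part of the value of a simple commutator. -/
def SimpleComm.mat : SimpleComm → Mat K
  | .x => matX
  | .a i => μ i
  | .bracket u v =>
    u.mat * v.mat - (-1 : K) ^ (u.letters.length * v.letters.length) • (v.mat * u.mat)

/-- The value of a simple commutator, minus `1`. -/
noncomputable def SimpleComm.nil (s : SimpleComm) : Model K := mono s.letters (s.mat μ)

variable {μ}

theorem SimpleComm.nil_bracket (u v : SimpleComm) :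
    (SimpleComm.bracket u v).nil μ = u.nil μ * v.nil μ - v.nil μ * u.nil μ := by
  rw [nil, nil, nil, mono_mul, mono_mul' v.letters, ← mono_sub,
    mul_comm v.letters.length]
  rfl

theorem SimpleComm.even_type_sub (s : SimpleComm) : Even (s.type - s.letters.length) := by
  rw [length_letters]
  exact ⟨-s.xWeight, by rw [type]; ring⟩

/-- The letter `x` is excluded because `matX` is a matrix of degree `-2` that need not vanish.
Brackets with `x` therefore need separate cases, where an even element lowers the degree by `2`. -/
theorem SimpleComm.isGraded_mat (hμ : ∀ i, IsGraded 1 (μ i)) {s : SimpleComm} (hs : s ≠ .x) : IsGraded s.type (s.mat μ) := by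
  induction s with
  | x => exact absurd rfl hs
  | a i => exact hμ i
  | bracket u v hu hv =>
    rw [type_bracket]
    by_cases hux : u = .x
    · subst hux
      by_cases hvx : v = .x
      · subst hvx
        simp only [mat, matX_mul_matX, smul_zero, sub_zero]
        exact .null _
      · have := (hv hvx).matX_bracket
        simpa [mat, letters, type, xWeight, aWeight, sub_eq_neg_add, add_comm] using this
    · by_cases hvx : v = .x
      · subst hvx
        have := (hu hux).matX_bracket.neg_mem
        rw [neg_sub] at this
        simpa [mat, letters, type, xWeight, aWeight, sub_eq_add_neg] using this
      · exact (hu hux).bracket (hv hvx) u.even_type_sub v.even_type_sub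

theorem SimpleComm.eq_x_or_mat_eq_zero (hμ : ∀ i, IsGraded 1 (μ i)) {s : SimpleComm}
    (h : s.letters = []) : s = .x ∨ s.mat μ = 0 := by
  refine or_iff_not_imp_left.2 fun hs => (isGraded_mat hμ hs).eq_zero ?_
  have h₀ : s.aWeight = 0 := by rw [← length_letters, h]; rfl
  have := s.weight_pos
  rw [type, le_abs]
  right
  omega

theorem mono_mul_self {l : List ℕ} (hl : l ≠ []) (m n : Mat K) : mono l m * mono l n = 0 := by
  rw [mono_mul]
  refine mono_eq_zero ?_ _
  obtain ⟨i, l', rfl⟩ := List.exists_cons_of_ne_nil hl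
  simp

theorem mono_mul_mul_self {l : List ℕ} (hl : l ≠ []) (l' : List ℕ) (m n k : Mat K) :
    mono l m * mono l' n * mono l k = 0 := by
  rw [mono_mul, mono_mul]
  refine mono_eq_zero ?_ _
  obtain ⟨i, l', rfl⟩ := List.exists_cons_of_ne_nil hl
  simp

theorem SimpleComm.nil_mul_self (hμ : ∀ i, IsGraded 1 (μ i)) (s : SimpleComm) :
    s.nil μ * s.nil μ = 0 := by
  by_cases h : s.letters = []
  · rcases eq_x_or_mat_eq_zero hμ h with rfl | h'
    · rw [nil, mono_mul, mat, matX_mul_matX, mono_zero]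
    · rw [nil, h', mono_zero, zero_mul]
  · exact mono_mul_self h _ _

/-- If `u` contains some `aᵢ`, that letter is repeated in the product. Otherwise `u` is `x` or
contributes `0`, and the claim is the matrix identity for `matX * m * matX`. -/
theorem SimpleComm.nil_mul_mul_self (hμ : ∀ i, IsGraded 1 (μ i)) (u v : SimpleComm) :
    u.nil μ * v.nil μ * u.nil μ = 0 := by
  by_cases h : u.letters = []
  · rcases eq_x_or_mat_eq_zero hμ h with rfl | h'
    · rw [nil, nil, mono_mul, mono_mul, mat]
      by_cases hv : v = .x
      · rw [hv, mat, matX_mul_matX, zero_mul, mono_zero]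
      · rw [(isGraded_mat hμ hv).matX_mul_mul_matX, mono_zero]
    · rw [nil, h', mono_zero, zero_mul, zero_mul]
  · exact mono_mul_mul_self h _ _ _ _

theorem SimpleComm.val_eval (hμ : ∀ i, IsGraded 1 (μ i)) {gx : (Model K)ˣ} {ga : ℕ → (Model K)ˣ}
    (hx : (gx : Model K) = 1 + mono [] matX) (ha : ∀ i, (ga i : Model K) = 1 + mono [i] (μ i))
    (s : SimpleComm) : ((s.eval gx ga : (Model K)ˣ) : Model K) = 1 + s.nil μ := by
  induction s with
  | x => exact hx
  | a i => exact ha i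
  | bracket u v hu hv =>
    rw [eval, nil_bracket]
    exact val_comm hu hv (nil_mul_self hμ u) (nil_mul_self hμ v) (nil_mul_mul_self hμ u v)
      (nil_mul_mul_self hμ v u)

end Graded

/-! ### The representation of the free group -/

section Representation

variable {K : Type*} [CommRing K]

/-- The matrices attached to the `aᵢ`; the one attached to `a₀` is scaled by `d`. -/
def matA (d : K) (i : ℕ) : Mat K :=
  if i = 0 then matOne 0 0 d else if Odd i then matOne 1 0 0 else matOne 0 1 0

theorem isGraded_matA (d : K) (i : ℕ) : IsGraded 1 (matA d i) := by
  unfold matA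
  split_ifs <;> exact .one _ _ _

/-- The nilpotent parts of the images of the generators. -/
noncomputable def nilGen (d : K) : Var → Model K
  | none => mono [] matX
  | some i => mono [i] (matA d i)

theorem nilGen_mul_self (d : K) (o : Var) : nilGen d o * nilGen d o = 0 := by
  cases o with
  | none => exact SimpleComm.nil_mul_self (isGraded_matA d) .x
  | some i => exact SimpleComm.nil_mul_self (isGraded_matA d) (.a i)

/-- The matrix representation of the free group. -/
noncomputable def rep (d : K) : FreeGroup Var →* (Model K)ˣ :=
  FreeGroup.lift fun o => oneAddUnit (nilGen d o) (nilGen_mul_self d o)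

theorem rep_of (d : K) (o : Var) : (rep d (FreeGroup.of o) : Model K) = 1 + nilGen d o := by
  rw [rep, FreeGroup.lift_apply_of]
  rfl

theorem rep_eval (d : K) (s : SimpleComm) :
    (rep d (s.eval freeX freeA) : Model K) = 1 + s.nil (matA d) := by
  rw [map_eval]
  exact s.val_eval (isGraded_matA d) (rep_of d none) fun i => rep_of d (some i)

/-- The ideal generated by a generator of the exterior algebra. -/
noncomputable def letterIdeal (K : Type*) [CommRing K] (i : ℕ) : AddSubgroup (Model K) :=
  AddSubgroup.closure {z | ∃ l m, i ∈ l ∧ mono l m = z}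

theorem mul_mem_letterIdeal {i : ℕ} (l : List ℕ) (m : Mat K) {z : Model K}
    (hz : z ∈ letterIdeal K i) :
    mono l m * z ∈ letterIdeal K i ∧ z * mono l m ∈ letterIdeal K i := by
  induction hz using AddSubgroup.closure_induction with
  | mem z hz =>
    obtain ⟨l', m', h, rfl⟩ := hz
    rw [mono_mul, mono_mul]
    exact ⟨AddSubgroup.subset_closure ⟨_, _, List.mem_append_right _ h, rfl⟩,
      AddSubgroup.subset_closure ⟨_, _, List.mem_append_left _ h, rfl⟩⟩
  | zero => simp [zero_mem]
  | add y z _ _ hy hz =>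
    rw [mul_add, add_mul]
    exact ⟨add_mem hy.1 hz.1, add_mem hy.2 hz.2⟩
  | neg z _ hz =>
    rw [mul_neg, neg_mul]
    exact ⟨neg_mem hz.1, neg_mem hz.2⟩

theorem exists_nilGen_eq (d : K) (o : Var) : ∃ l m, nilGen d o = mono l m := by
  cases o <;> exact ⟨_, _, rfl⟩

/-- Elements of the additive closure of a commuting set commute. -/
theorem mul_comm_of_mem_addClosure {A : Type*} [Ring A] {S : Set A}
    (hS : ∀ y ∈ S, ∀ z ∈ S, y * z = z * y) :
    ∀ y ∈ AddSubgroup.closure S, ∀ z ∈ AddSubgroup.closure S, y * z = z * y := by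
  intro y hy z hz
  induction hy, hz using AddSubgroup.closure_induction₂ with
  | mem y z hy hz => exact hS y hy z hz
  | zero_left => simp
  | zero_right => simp
  | add_left _ _ _ _ _ _ h h' => rw [add_mul, mul_add, h, h']
  | add_right _ _ _ _ _ _ h h' => rw [add_mul, mul_add, h, h']
  | neg_left _ _ _ _ h => rw [neg_mul, mul_neg, h]
  | neg_right _ _ _ _ h => rw [neg_mul, mul_neg, h]

/-- Any two elements of `letterIdeal K i` have product zero, since the letter `i` is repeated. -/
theorem rep_commute_of_mem_normalClosure_freeA (d : K) (i : ℕ) :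
    ∀ g ∈ normalClosure {freeA i}, ∀ h ∈ normalClosure {freeA i},
      rep d g * rep d h = rep d h * rep d g := by
  refine commute_of_mem_normalClosure (rep d) (letterIdeal K i) ?_ ?_ ?_
  · refine mul_comm_of_mem_addClosure ?_
    rintro _ ⟨l, m, h, rfl⟩ _ ⟨l', m', h', rfl⟩
    rw [mono_mul, mono_mul, mono_eq_zero, mono_eq_zero]
    · exact fun hd => List.disjoint_of_nodup_append hd h' h
    · exact fun hd => List.disjoint_of_nodup_append hd h h'
  · intro o
    refine ⟨_, nilGen_mul_self d o, rep_of d o, fun z hz => ?_⟩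
    obtain ⟨l, m, e⟩ := exists_nilGen_eq d o
    rw [e]
    have := mul_mem_letterIdeal l m hz
    exact ⟨sub_mem this.1 this.2, (mul_mem_letterIdeal l m this.1).2⟩
  · exact ⟨_, AddSubgroup.subset_closure ⟨[i], matA d i, by simp, rfl⟩, rep_of d (some i)⟩

/-- The matrices occurring in conjugates of `x`, by the parity of their coefficients. -/
inductive IsCore : ℕ → Mat K → Prop
  | x (k : ℕ) (hk : Even k) : IsCore k matX
  | zero (k : ℕ) (hk : Even k) (a : K) : IsCore k (matZero a 0 0)
  | neg (k : ℕ) (hk : Odd k) (a b : K) : IsCore k (matNeg a b 0)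

/-- The additive subgroup containing `g - 1` for all conjugates `g` of `x`. -/
noncomputable def core (K : Type*) [CommRing K] : AddSubgroup (Model K) :=
  AddSubgroup.closure {z | ∃ l m, IsCore l.length m ∧ mono l m = z}

/-- The `matNeg` matrices anticommute, but their coefficients are odd and anticommute too; the
remaining pairs commute and involve an even coefficient. -/
theorem core_mul_comm : ∀ y ∈ core K, ∀ z ∈ core K, y * z = z * y := by
  refine mul_comm_of_mem_addClosure ?_
  have scal : ∀ a b c : K, matZero a 0 0 * matNeg b c 0 = matNeg b c 0 * matZero a 0 0 := by
    intro a b c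
    rw [← sub_eq_zero, matZero_mul_matNeg]
    simpa using matNeg_zero
  rintro _ ⟨l, m, h, rfl⟩ _ ⟨l', m', h', rfl⟩
  rw [mono_mul, mono_mul']
  congr 1
  generalize l.length = k at h
  generalize l'.length = k' at h'
  cases h with
  | x hk =>
    rw [(hk.mul_left k').neg_one_pow, one_smul]
    cases h' with
    | x => rfl
    | zero => rw [matX_mul_matZero, matZero_mul_matX]
    | neg => rw [matX_mul_matNeg, matNeg_mul_matX]
  | zero hk a =>
    rw [(hk.mul_left k').neg_one_pow, one_smul]
    cases h' with
    | x => rw [matX_mul_matZero, matZero_mul_matX]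
    | zero _ b =>
      rw [← sub_eq_zero, matZero_mul_matZero]
      simp [matZero, ← Matrix.ext_iff, Fin.forall_fin_succ]
    | neg => rw [scal]
  | neg hk a b =>
    cases h' with
    | x hk' =>
      rw [(hk'.mul_right k).neg_one_pow, one_smul, matX_mul_matNeg, matNeg_mul_matX]
    | zero hk' => rw [(hk'.mul_right k).neg_one_pow, one_smul, scal]
    | neg hk' =>
      rw [(hk'.mul hk).neg_one_pow, neg_one_smul, ← add_eq_zero_iff_eq_neg, matNeg_mul_matNeg]

theorem exists_matA_zero_eq (i : ℕ) : ∃ a b : K, matA 0 i = matOne a b 0 := by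
  unfold matA
  split_ifs <;> exact ⟨_, _, rfl⟩

/-- With `d = 0` the last column of the generators vanishes. Bracketing with a generator `aᵢ` sends
multiples of `matX` to `matNeg`, then to scalars on the block, then to `0`, so the list in `IsCore`
is closed. -/
theorem nilGen_core (o : Var) {z : Model K} (hz : z ∈ core K) :
    nilGen 0 o * z - z * nilGen 0 o ∈ core K ∧ nilGen 0 o * z * nilGen 0 o ∈ core K := by
  induction hz using AddSubgroup.closure_induction with
  | mem z hz =>
    obtain ⟨l, m, h, rfl⟩ := hz
    cases o with
    | none =>
      have h₁ : matX * m = m * matX := by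
        cases h with
        | x => rfl
        | zero => rw [matX_mul_matZero, matZero_mul_matX]
        | neg => rw [matX_mul_matNeg, matNeg_mul_matX]
      rw [nilGen, mono_mul, mono_mul, mono_mul, h₁, mul_assoc, matX_mul_matX, mul_zero, mono_zero,
        List.nil_append, List.append_nil, sub_self]
      exact ⟨zero_mem _, zero_mem _⟩
    | some i =>
      rw [nilGen, mono_mul_mul_self (by simp)]
      refine ⟨?_, zero_mem _⟩
      obtain ⟨a, b, e⟩ := exists_matA_zero_eq (K := K) i
      rw [e, mono_mul', mono_mul, ← mono_sub, List.length_singleton, one_mul]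
      have len : (l ++ [i]).length = l.length + 1 := by simp
      refine AddSubgroup.subset_closure ⟨_, _, ?_, rfl⟩
      rw [len]
      generalize l.length = k at h
      cases h with
      | x hk =>
        have := matX_mul_matOne_sub a b 0
        rw [hk.neg_one_pow, one_smul, ← neg_sub, this, ← matNeg_neg, neg_zero]
        exact .neg _ hk.add_one _ _
      | zero hk c =>
        have := matZero_mul_matOne c 0 0 a b 0
        rw [hk.neg_one_pow, one_smul, ← neg_sub, this]
        simp only [mul_zero, add_zero, sub_zero, matOne_zero, neg_zero]
        rw [← matNeg_zero]
        exact .neg _ hk.add_one _ _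
      | neg hk a' b' =>
        have := matOne_mul_matNeg a b 0 a' b' 0
        rw [hk.neg_one_pow, neg_one_smul, sub_eq_add_neg, ← neg_add, this, ← matZero_neg]
        simp only [mul_zero, sub_zero, neg_zero]
        exact .zero _ hk.add_one _
  | zero => simp [zero_mem]
  | add y z _ _ hy hz =>
    have e₁ : nilGen 0 o * (y + z) - (y + z) * nilGen 0 o =
        (nilGen 0 o * y - y * nilGen 0 o) + (nilGen 0 o * z - z * nilGen 0 o) := by noncomm_ring
    rw [e₁, mul_add, add_mul]
    exact ⟨add_mem hy.1 hz.1, add_mem hy.2 hz.2⟩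
  | neg z _ hz =>
    have e₁ : nilGen 0 o * -z - -z * nilGen 0 o = -(nilGen 0 o * z - z * nilGen 0 o) := by
      noncomm_ring
    rw [e₁, mul_neg, neg_mul]
    exact ⟨neg_mem hz.1, neg_mem hz.2⟩

theorem rep_zero_commute_of_mem_normalClosure_freeX :
    ∀ g ∈ normalClosure {freeX}, ∀ h ∈ normalClosure {freeX},
      rep (0 : K) g * rep 0 h = rep 0 h * rep 0 g :=
  commute_of_mem_normalClosure (rep 0) (core K) core_mul_comm
    (fun o => ⟨_, nilGen_mul_self 0 o, rep_of 0 o, fun _ hz => nilGen_core o hz⟩)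
    ⟨_, AddSubgroup.subset_closure ⟨[], matX, .x 0 (by simp), rfl⟩, rep_of 0 none⟩

/-- The projection onto the upper left `4 × 4` block. -/
noncomputable def blockProj (K : Type*) [CommRing K] : Model K := mono [] (matZero 1 0 0)

theorem nilGen_mul_blockProj (d : K) (o : Var) :
    nilGen d o * blockProj K = blockProj K * nilGen 0 o ∧
      blockProj K * nilGen d o = nilGen d o := by
  cases o with
  | none =>
    simp only [nilGen, blockProj, mono_mul, matX_mul_matZero, matZero_mul_matX, one_smul,
      List.nil_append, and_self]
  | some i =>
    simp only [nilGen, blockProj, mono_mul, List.nil_append, List.append_nil]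
    unfold matA
    constructor <;> congr 1 <;> split_ifs <;>
      (rw [← Matrix.ext_iff]; simp [matOne, matZero, Fin.forall_fin_succ])

/-- Every value of `rep d` is block triangular: its upper left block is that of `rep 0`, and its
last row is that of the identity. -/
theorem rep_mul_blockProj (d : K) (g : FreeGroup Var) :
    (rep d g : Model K) * blockProj K = blockProj K * (rep (0 : K) g : Model K) ∧
      (1 - blockProj K) * (rep d g : Model K) = 1 - blockProj K := by
  induction g using FreeGroup.induction_on with
  | C1 => simp
  | of o =>
    rw [rep_of, rep_of, add_mul, mul_add, one_mul, mul_one, (nilGen_mul_blockProj d o).1, mul_add,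
      sub_mul _ _ (nilGen d o), (nilGen_mul_blockProj d o).2]
    simp
  | inv_of o ih =>
    constructor
    · rw [map_inv, map_inv, Units.inv_mul_eq_iff_eq_mul, ← mul_assoc, ih.1, mul_assoc,
        Units.mul_inv, mul_one]
    · rw [map_inv, Units.mul_inv_eq_iff_eq_mul, ih.2]
  | mul u v hu hv =>
    simp only [map_mul, Units.val_mul]
    exact ⟨by rw [mul_assoc, hv.1, ← mul_assoc, hu.1, mul_assoc],
      by rw [← mul_assoc, hu.2, hv.2]⟩

/-- Such elements differ from `1` only in the last column above the bottom entry, and such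
differences multiply to zero. Together with commutativity of the conjugates of `x` under `rep 0`,
this yields condition 2. -/
theorem rep_commute_of_rep_zero_eq_one (d : K) {g h : FreeGroup Var} (hg : rep (0 : K) g = 1)
    (hh : rep (0 : K) h = 1) : rep d g * rep d h = rep d h * rep d g := by
  have key : ∀ g h : FreeGroup Var, rep (0 : K) g = 1 →
      ((rep d g : Model K) - 1) * ((rep d h : Model K) - 1) = 0 := by
    intro g h hg
    have h₁ : ((rep d g : Model K) - 1) * blockProj K = 0 := by
      rw [sub_mul, (rep_mul_blockProj d g).1, hg, Units.val_one, mul_one, one_mul, sub_self]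
    have h₂ : (rep d h : Model K) - 1 = blockProj K * ((rep d h : Model K) - 1) := by
      have : (1 - blockProj K) * ((rep d h : Model K) - 1) = 0 := by
        rw [mul_sub, (rep_mul_blockProj d h).2, mul_one, sub_self]
      rwa [sub_mul, one_mul, sub_eq_zero] at this
    rw [h₂, ← mul_assoc, h₁, zero_mul]
  have h₁ := key g h hg
  have h₂ := key h g hh
  apply Units.ext
  simp only [Units.val_mul]
  have h₃ := h₁.trans h₂.symm
  simp only [sub_mul, mul_sub, one_mul, mul_one] at h₃
  have h₄ : ∀ a b c d : Model K, a - c - (d - 1) = b - d - (c - 1) → a = b := by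
    intro a b c d e
    have : a - b = (a - c - (d - 1)) - (b - d - (c - 1)) := by abel
    rwa [e, sub_self, sub_eq_zero] at this
  exact h₄ _ _ _ _ h₃

end Representation

/-! ### The representation of the Engel group -/

theorem rep_of_pow {p : ℕ} (o : Var) : rep (1 : ZMod p) (FreeGroup.of o) ^ p = 1 := by
  apply Units.ext
  rw [Units.val_pow_eq_pow_val, rep_of, one_add_pow_of_sq_eq_zero (nilGen_mul_self 1 o),
    ← Nat.cast_smul_eq_nsmul (ZMod p), ZMod.natCast_self, zero_smul, add_zero, Units.val_one]

theorem rep_eq_one_of_relator {p : ℕ} {r : FreeGroup Var} (hr : Relator p r) :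
    rep (1 : ZMod p) r = 1 := by
  cases hr with
  | abelian i g h hg hh =>
    rw [map_comm, comm_eq_one_iff]
    exact rep_commute_of_mem_normalClosure_freeA 1 i g hg h hh
  | metabelian g₁ g₂ g₃ g₄ h₁ h₂ h₃ h₄ =>
    rw [map_comm, comm_eq_one_iff]
    refine rep_commute_of_rep_zero_eq_one 1 ?_ ?_
    · rw [map_comm, comm_eq_one_iff]
      exact rep_zero_commute_of_mem_normalClosure_freeX _ h₁ _ h₂
    · rw [map_comm, comm_eq_one_iff]
      exact rep_zero_commute_of_mem_normalClosure_freeX _ h₃ _ h₄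
  | x_pow => rw [map_pow]; exact rep_of_pow none
  | a_pow i => rw [map_pow]; exact rep_of_pow (some i)
  | simple s hs ht =>
    apply Units.ext
    rw [rep_eval, SimpleComm.nil,
      (SimpleComm.isGraded_mat (isGraded_matA 1) hs).eq_zero ht, mono_zero, add_zero, Units.val_one]

/-- The matrix representation of the Engel group. -/
noncomputable def engelRep (p : ℕ) : EngelGroup p →* (Model (ZMod p))ˣ :=
  QuotientGroup.lift _ (rep 1) (normalClosure_le_normal (N := (rep 1).ker)
    fun _ hr => rep_eq_one_of_relator hr)

theorem engelRep_eval {p : ℕ} (s : SimpleComm) :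
    ((engelRep p (s.eval (genX p) (genA p)) : (Model (ZMod p))ˣ) : Model (ZMod p)) = 1 + s.nil (matA 1) := by
  rw [map_eval]
  exact s.val_eval (isGraded_matA 1) (rep_of 1 none) fun i => rep_of 1 (some i)

/-! ### Nontrivial commutators of every length in the normal closure of `x`. -/

/-- The simple commutators `[a₀, x, [x, a₁, a₂], [x, a₃, a₄], …]`. -/
def longComm : ℕ → SimpleComm
  | 0 => .bracket (.a 0) .x
  | n + 1 => .bracket (longComm n)
      (.bracket (.bracket .x (.a (2 * n + 1))) (.a (2 * n + 2)))

theorem letters_longComm (n : ℕ) : (longComm n).letters = List.range (2 * n + 1) := by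
  induction n with
  | zero => rfl
  | succ n ih =>
    simp [longComm, SimpleComm.letters, ih, show 2 * (n + 1) + 1 = 2 * n + 1 + 1 + 1 by ring,
      List.range_succ]

/-- The inner bracket `[x, a₂ₙ₊₁, a₂ₙ₊₂]` has matrix `matZero 1 0 0`, the projection onto the block,
whose commutator with `matNeg 0 0 e` is `matNeg 0 0 e`. Each step thus only changes the sign of the
unit `e`. -/
theorem mat_longComm {K : Type*} [CommRing K] (n : ℕ) :
    ∃ e : Kˣ, (longComm n).mat (matA (1 : K)) = matNeg 0 0 (e : K) := by
  induction n with
  | zero =>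
    refine ⟨-1, ?_⟩
    have := matX_mul_matOne_sub (0 : K) 0 1
    simp only [longComm, SimpleComm.mat, SimpleComm.letters, matA, List.length_nil, mul_zero,
      pow_zero, one_smul, if_true]
    rw [← neg_sub, this, ← matNeg_neg]
    simp
  | succ n ih =>
    obtain ⟨e, ih⟩ := ih
    refine ⟨-e, ?_⟩
    have h₁ : matA (1 : K) (2 * n + 1) = matOne 1 0 0 := by simp [matA]
    have h₂ : matA (1 : K) (2 * n + 2) = matOne 0 1 0 := by
      simp [matA, show ¬ Odd (2 * n + 2) from Nat.not_odd_iff_even.2 ⟨n + 1, by ring⟩]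
    have h₃ : (SimpleComm.bracket (.bracket .x (.a (2 * n + 1))) (.a (2 * n + 2))).mat
        (matA (1 : K)) = matZero 1 0 0 := by
      have h₄ := matX_mul_matOne_sub (1 : K) 0 0
      have h₅ := matOne_mul_matNeg (0 : K) 1 0 1 0 0
      simp only [SimpleComm.mat, SimpleComm.letters, h₁, h₂, List.length_nil, pow_zero,
        one_smul, h₄, List.nil_append, List.length_singleton, mul_one, pow_one, neg_one_smul,
        sub_neg_eq_add]
      rw [add_comm, h₅]
      simp
    -- The bracket is taken in the opposite order, which produces `-e`.
    have h₆ := matZero_mul_matNeg (1 : K) 0 0 0 0 e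
    rw [longComm, SimpleComm.mat, h₃, ih]
    simp only [SimpleComm.letters, List.length_append, List.length_nil, List.length_singleton]
    rw [Even.neg_one_pow (by simp), one_smul, ← neg_sub, h₆, ← matNeg_neg]
    simp

theorem eval_longComm_ne_one {p : ℕ} (hp : p.Prime) (n : ℕ) :
    (longComm n).eval (genX p) (genA p) ≠ 1 := by
  have := Fact.mk hp
  intro h
  have h₁ := engelRep_eval (p := p) (longComm n)
  rw [h, map_one, Units.val_one, left_eq_add] at h₁
  obtain ⟨e, he⟩ := mat_longComm (K := ZMod p) n
  -- Entry `(0, 4)` is where `matNeg 0 0 e` carries `e`.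
  refine mono_ne_zero (i := 0) (j := 4) ?_ ?_ h₁
  · rw [letters_longComm]
    exact List.nodup_range
  · rw [he]
    simp [matNeg]

theorem exists_mem_lowerCentralSeries (p n : ℕ) :
    ∃ g ∈ (⊤ : Subgroup (normalClosure {genX p})).lowerCentralSeries n,
      (g : EngelGroup p) = (longComm n).eval (genX p) (genA p) := by
  induction n with
  | zero => exact ⟨⟨(longComm 0).eval (genX p) (genA p),
      SimpleComm.eval_mem_normalClosure_x (by simp [longComm, SimpleComm.xWeight])⟩,
      mem_top _, rfl⟩
  | succ n ih =>
    obtain ⟨g, hg, e⟩ := ih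
    let k : normalClosure {genX p} :=
      ⟨(SimpleComm.bracket (.bracket .x (.a (2 * n + 1))) (.a (2 * n + 2))).eval (genX p) (genA p),
        SimpleComm.eval_mem_normalClosure_x (by simp [SimpleComm.xWeight])⟩
    refine ⟨comm g k, ?_, ?_⟩
    -- In Mathlib's convention `comm g k` is `⁅g⁻¹, k⁻¹⁆`.
    · have := commutator_mem_commutator (inv_mem hg) (mem_top k⁻¹)
      simpa [Subgroup.lowerCentralSeries_succ, comm, commutatorElement_def] using this
    · change comm (g : EngelGroup p) _ = _
      rw [e]
      rfl

theorem not_isNilpotent_normalClosure_genX {p : ℕ} (hp : p.Prime) :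
    ¬ Group.IsNilpotent (normalClosure {genX p}) := by
  intro h
  obtain ⟨n, hn⟩ := Subgroup.nilpotent_iff_lowerCentralSeries.1 h
  obtain ⟨g, hg, e⟩ := exists_mem_lowerCentralSeries p n
  rw [hn, mem_bot] at hg
  refine eval_longComm_ne_one hp n ?_
  rw [← e, hg]
  rfl

end EngelExample

theorem theorem5p1 (p : ℕ) (hp : p.Prime) (hodd : Odd p) :
    IsPGroup p (EngelExample.EngelGroup p) ∧
    EngelExample.IsLocallyFiniteGroup (EngelExample.EngelGroup p) ∧
    EngelExample.IsLeftEngel 3 (EngelExample.genX p) ∧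
    ¬ Group.IsNilpotent (Subgroup.normalClosure {EngelExample.genX p}) :=
  ⟨(EngelExample.isAdmissible_engelGroup p).isPGroup,
    (EngelExample.isAdmissible_engelGroup p).isLocallyFiniteGroup hp,
    EngelExample.isLeftEngel_genX hp, EngelExample.not_isNilpotent_normalClosure_genX hp⟩
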